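/- Conventions. A lattice is a free $\mathbb Z$-module of finite rank with an integral symmetric bilinear form $(\cdot,\cdot)$, even if all $x^2=(x,x)$ are even; $L(n)$ is $L$ with the form multiplied by $n$; $U$ is the hyperbolic plane, $A_2,E_8$ are the positive definite root lattices, and $\langle n\rangle$ is the rank one lattice generated by a vector of square $n$. For an even non-degenerate lattice $L$, $L^\vee=\{x\in L\otimes\mathbb Q: (x,L)\subseteq\mathbb Z\}$, and $D(L)=L^\vee/L$ carries the quadratic form $q_L(x+L)=(x,x)+2\mathbb Z\in\mathbb Q/2\mathbb Z$. For $g\in \mathrm O(L)$ let $\bar g$ be the induced automorphism of $D(L)$, and let $\widetilde{\mathrm O}(L)$ be the group of $g$ with $\bar g=\mathrm{id}$. For $L$ of signature $(2,n)$, $\mathrm O^+(L)$ is the group of $g\in\mathrm O(L)$ that map each connected component of $\Omega(L)=\{[v]\in\mathbb P(L\otimes\mathbb C): (v,v)=0,\ (v,\bar v)>0\}$ to itself, and $\widetilde{\mathrm O}^+(L)=\widetilde{\mathrm O}(L)\cap \mathrm O^+(L)$. The divisor $\mathrm{div}(h)$ of $h\in L$ is the positive generator of the ideal $(h,L)\subseteq\mathbb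 Z$. A subgroup of a discriminant group is totally isotropic if the discriminant quadratic form vanishes on it. Theorem. Let $L_A=3U\oplus 2E_8(-1)\oplus A_2(-1)$, let $d\ge 1$ be an integer, let $h\in L_A$ be a primitive vector with $h^2=2d$, and let $L_h=h^\perp_{L_A}$. Let $\mathrm O^+(L_A,h)$ be the group of all $g\in\mathrm O(L_A)$ with $g(h)=h$ and $g|_{L_h}\in\mathrm O^+(L_h)$. Then $L_h$ has signature $(2,21)$, and the following hold. 1. If $\mathrm{div}(h)=3$, then there is a lattice $Q$ such that $Q(-1)$ is a negative definite even lattice of rank $3$ and determinant $-2d/3$, with $$L_h\cong 2U\oplus 2E_8(-1)\oplus Q(-1),$$ and $D(Q(-1))\cong D(L_h)$ (compatibly with the quadratic forms) is cyclic of order $2d/3$. Moreover restriction $g\mapsto g|_{L_h}$ is an isomorphism $\mathrm O^+(L_A,h)\cong\widetilde{\mathrm O}^+(L_h)$. 2. If $\mathrm{div}(h)=1$, put $L_{A,2d}=2U\oplus 2E_8(-1)\oplus A_2(-1)\oplus\langle -2d\rangle$. Then $D(L_h)\cong D(A_2(-1))\oplus D(\langle -2d\rangle)$ (compatibly with the quadratic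 forms), and there is an isometry $\varphi: L_h\to L_{A,2d}$ such that $g\mapsto \varphi\circ g|_{L_h}\circ\varphi^{-1}$ is an isomorphism $$\mathrm O^+(L_A,h)\cong \mathrm O_G(L_{A,2d})=\{g\in\mathrm O^+(L_{A,2d}) : \bar g|_{D(\langle -2d\rangle)}=\mathrm{id}\}.$$ 3. In both cases every totally isotropic subgroup of $D(L_h)$ is cyclic. Moreover, whatever $\mathrm{div}(h)$ is, every totally isotropic subgroup of $D(A_2(-1))\oplus D(\langle -2d\rangle)$ is cyclic. -/

import Mathlib

open scoped TensorProduct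

noncomputable section

/-- An even integral lattice: a free `ℤ`-module of finite rank with a symmetric integral
bilinear form such that `(x, x)` is always even.  (Non-degeneracy is not built in.) -/
structure EvenLattice where
  carrier : Type
  [addCommGroup : AddCommGroup carrier]
  [free : Module.Free ℤ carrier]
  [finite : Module.Finite ℤ carrier]
  form : LinearMap.BilinForm ℤ carrier
  symm : ∀ x y, form x y = form y x
  even : ∀ x, Even (form x x)

namespace EvenLattice

instance : CoeSort EvenLattice Type := ⟨EvenLattice.carrier⟩

instance (L : EvenLattice) : AddCommGroup L := L.addCommGroup
instance (L : EvenLattice) : Module.Free ℤ L := L.free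
instance (L : EvenLattice) : Module.Finite ℤ L := L.finite

/-! ### Constructions and examples of lattices -/

theorem even_of_span {M : Type} [AddCommGroup M] (B : LinearMap.BilinForm ℤ M)
    (hs : ∀ x y, B x y = B y x) (s : Set M) (hspan : Submodule.span ℤ s = ⊤)
    (hb : ∀ x ∈ s, Even (B x x)) (x : M) : Even (B x x) := by
  have hx : x ∈ Submodule.span ℤ s := hspan ▸ Submodule.mem_top
  induction hx using Submodule.span_induction with
  | zero => simp
  | mem x h => exact hb x h
  | add x y _ _ hx hy =>
    have h : B (x + y) (x + y) = B x x + B y y + 2 * B x y := by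
      simp only [map_add, LinearMap.add_apply, hs y x]; ring
    rw [h]
    exact (hx.add hy).add (even_two_mul _)
  | smul c x _ hx =>
    have h : B (c • x) (c • x) = c * c * B x x := by
      simp only [map_smul, LinearMap.smul_apply, smul_eq_mul]; ring
    rw [h]
    exact hx.mul_left _

theorem toBilin'_symm {n : ℕ} (G : Matrix (Fin n) (Fin n) ℤ) (hs : G.IsSymm)
    (x y : Fin n → ℤ) : Matrix.toBilin' G x y = Matrix.toBilin' G y x := by
  rw [Matrix.toBilin'_apply', Matrix.toBilin'_apply', Matrix.dotProduct_mulVec,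
    ← Matrix.mulVec_transpose, hs.eq, dotProduct_comm]

/-- The lattice `ℤⁿ` with a given Gram matrix. -/
def ofGram {n : ℕ} (G : Matrix (Fin n) (Fin n) ℤ) (hs : G.IsSymm) (he : ∀ i, Even (G i i)) :
    EvenLattice where
  carrier := Fin n → ℤ
  form := Matrix.toBilin' G
  symm := toBilin'_symm G hs
  even := even_of_span _ (toBilin'_symm G hs) _ (Pi.basisFun ℤ (Fin n)).span_eq (by
    rintro _ ⟨i, rfl⟩
    simpa [Matrix.toBilin'_single] using he i)

/-- The orthogonal direct sum of two lattices. -/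
def sum (L M : EvenLattice) : EvenLattice where
  carrier := L × M
  form := L.form.compl₁₂ (LinearMap.fst ℤ L M) (LinearMap.fst ℤ L M) +
    M.form.compl₁₂ (LinearMap.snd ℤ L M) (LinearMap.snd ℤ L M)
  symm := fun x y => by simp [L.symm x.1 y.1, M.symm x.2 y.2]
  even := fun x => by simpa using (L.even x.1).add (M.even x.2)

infixr:35 " ⊞ " => EvenLattice.sum

theorem sum_form_apply (L M : EvenLattice) (x y : L × M) :
    (L ⊞ M).form x y = L.form x.1 y.1 + M.form x.2 y.2 := rfl

/-- The lattice `L(n)`: the module `L` with the form multiplied by `n`. -/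
def rescale (L : EvenLattice) (n : ℤ) : EvenLattice where
  carrier := L
  form := n • L.form
  symm := fun x y => by simp [L.symm x y]
  even := fun x => by simpa using (L.even x).mul_left n

/-- The hyperbolic plane. -/
def U : EvenLattice :=
  ofGram !![0, 1; 1, 0] (by decide) (by decide)

/-- The positive definite root lattice `E₈`. -/
def E8 : EvenLattice :=
  ofGram CartanMatrix.E₈ CartanMatrix.E₈_isSymm (fun i => by simp)

/-- The positive definite root lattice `A₂`. -/
def A2 : EvenLattice :=
  ofGram (CartanMatrix.A 2) (by decide) (by decide)

/-- The rank one lattice `⟨2k⟩`, generated by a vector of square `2k`. -/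
def rankOne (k : ℤ) : EvenLattice :=
  ofGram !![2 * k] (by ext i j; fin_cases i; fin_cases j; rfl)
    (fun i => by fin_cases i; exact even_two_mul k)

/-- `L_A = 3U ⊕ 2E₈(-1) ⊕ A₂(-1)`. -/
def LA : EvenLattice :=
  U ⊞ U ⊞ U ⊞ E8.rescale (-1) ⊞ E8.rescale (-1) ⊞ A2.rescale (-1)

/-- The lattice `2U ⊕ 2E₈(-1) ⊕ S`. -/
def twoUtwoE8 (S : EvenLattice) : EvenLattice :=
  U ⊞ U ⊞ E8.rescale (-1) ⊞ E8.rescale (-1) ⊞ S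

/-- `L_{A,2d} = (2U ⊕ 2E₈(-1) ⊕ A₂(-1)) ⊕ ⟨-2d⟩`. -/
def LA2d (d : ℕ) : EvenLattice :=
  twoUtwoE8 (A2.rescale (-1)) ⊞ rankOne (-d)

/-- The orthogonal complement `L_h = h^⊥` of a vector `h` in `L`. -/
def perp (L : EvenLattice) (h : L) : EvenLattice where
  carrier := LinearMap.ker (L.form h)
  form := L.form.compl₁₂ (LinearMap.ker (L.form h)).subtype (LinearMap.ker (L.form h)).subtype
  symm := fun _ _ => L.symm _ _
  even := fun _ => L.even _

/-- A vector of `L_h`, viewed as a vector of `L`. -/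
def perpVal {L : EvenLattice} {h : L} (x : L.perp h) : L :=
  Subtype.val (p := (· ∈ LinearMap.ker (L.form h))) x

/-! ### Invariants of lattices and vectors -/

/-- A vector is primitive if it is not a proper multiple of another lattice vector. -/
def IsPrimitive {L : EvenLattice} (h : L) : Prop :=
  ∀ (n : ℤ) (x : L), h = n • x → IsUnit n

/-- The divisor of `h`: the non-negative generator of the ideal `(h, L) ⊆ ℤ`. -/
def divisor {L : EvenLattice} (h : L) : ℕ :=
  (Submodule.IsPrincipal.generator (LinearMap.range (L.form h))).natAbs

/-- The determinant of a Gram matrix of `L` (over `ℤ` it does not depend on the basis). -/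
def det (L : EvenLattice) : ℤ :=
  (LinearMap.BilinForm.toMatrix (Module.finBasis ℤ L) L.form).det

/-- `L` is non-degenerate of signature `(p, q)`. -/
def HasSignature (L : EvenLattice) (p q : ℕ) : Prop :=
  Module.finrank ℤ L = p + q ∧
  sigPos (LinearMap.BilinMap.toQuadraticMap (L.form.baseChange ℝ)) = p ∧
  sigNeg (LinearMap.BilinMap.toQuadraticMap (L.form.baseChange ℝ)) = q

def IsNegDef (L : EvenLattice) : Prop := ∀ x : L, x ≠ 0 → L.form x x < 0

/-! ### The discriminant group and the discriminant quadratic form -/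

/-- The inclusion `L → L ⊗ ℚ`. -/
def toRat (L : EvenLattice) : L →+ ℚ ⊗[ℤ] L :=
  (TensorProduct.mk ℤ ℚ L 1).toAddMonoidHom

theorem toRat_apply (L : EvenLattice) (x : L) : L.toRat x = (1 : ℚ) ⊗ₜ[ℤ] x := rfl

/-- The rational extension of the form of `L` to `L ⊗ ℚ`. -/
abbrev formQ (L : EvenLattice) : LinearMap.BilinForm ℚ (ℚ ⊗[ℤ] L) := L.form.baseChange ℚ

/-- The dual lattice `L^∨ = {x ∈ L ⊗ ℚ : (x, L) ⊆ ℤ}`. -/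
def dual (L : EvenLattice) : AddSubgroup (ℚ ⊗[ℤ] L) where
  carrier := {x | ∀ l : L, ∃ n : ℤ, L.formQ x (L.toRat l) = n}
  add_mem' := fun {a b} ha hb l => by
    obtain ⟨m, hm⟩ := ha l
    obtain ⟨n, hn⟩ := hb l
    exact ⟨m + n, by simp only [map_add, LinearMap.add_apply, hm, hn]; push_cast; rfl⟩
  zero_mem' := fun l => ⟨0, by simp⟩
  neg_mem' := fun {a} ha l => by
    obtain ⟨m, hm⟩ := ha l
    exact ⟨-m, by simp only [map_neg, LinearMap.neg_apply, hm]; push_cast; rfl⟩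

/-- The discriminant group `D(L) = L^∨ / L`. -/
abbrev D (L : EvenLattice) : Type := L.dual ⧸ L.toRat.range.addSubgroupOf L.dual

theorem formQ_symm (L : EvenLattice) (x y : ℚ ⊗[ℤ] L) : L.formQ x y = L.formQ y x := by
  have h : LinearMap.IsSymm L.form := ⟨fun x y => L.symm x y⟩
  exact (LinearMap.BilinForm.IsSymm.baseChange ℚ h).eq x y

theorem disc_well_defined (L : EvenLattice) (x y : L.dual)
    (h : -x + y ∈ L.toRat.range.addSubgroupOf L.dual) :
    ((L.formQ (x : ℚ ⊗[ℤ] L) x : ℚ) : ℚ ⧸ AddSubgroup.zmultiples (2 : ℚ)) =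
      ((L.formQ (y : ℚ ⊗[ℤ] L) y : ℚ) : ℚ ⧸ AddSubgroup.zmultiples (2 : ℚ)) := by
  obtain ⟨l, hl⟩ : ∃ l : L, L.toRat l = -(x : ℚ ⊗[ℤ] L) + y := h
  have hy : (y : ℚ ⊗[ℤ] L) = x + L.toRat l := by rw [hl]; abel
  obtain ⟨m, hm⟩ := x.2 l
  obtain ⟨k, hk⟩ := L.even l
  have hll : L.formQ (L.toRat l) (L.toRat l) = k + k := by
    simp [toRat_apply, LinearMap.BilinForm.baseChange_tmul, hk]
  rw [QuotientAddGroup.eq]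
  refine ⟨m + k, ?_⟩
  rw [hy]
  simp only [map_add, LinearMap.add_apply, L.formQ_symm (L.toRat l) x, hm, hll, zsmul_eq_mul]
  push_cast
  ring

/-- The discriminant quadratic form `q_L : D(L) → ℚ/2ℤ`, `q_L(x + L) = (x, x) + 2ℤ`. -/
def q (L : EvenLattice) : L.D → ℚ ⧸ AddSubgroup.zmultiples (2 : ℚ) :=
  Quotient.lift
    (fun x : L.dual => ((L.formQ (x : ℚ ⊗[ℤ] L) x : ℚ) :
      ℚ ⧸ AddSubgroup.zmultiples (2 : ℚ)))
    (fun x y h => L.disc_well_defined x y (QuotientAddGroup.leftRel_apply.1 h))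

/-- An isomorphism `D(L) ≅ D(M)` of discriminant groups with their quadratic forms. -/
structure DiscIso (L M : EvenLattice) where
  toEquiv : L.D ≃+ M.D
  map_q : ∀ x, M.q (toEquiv x) = L.q x

/-- An isomorphism `D(L) ≅ D(M) ⊕ D(N)` of discriminant groups with their quadratic forms. -/
structure DiscSumIso (L M N : EvenLattice) where
  toEquiv : L.D ≃+ M.D × N.D
  map_q : ∀ x, M.q (toEquiv x).1 + N.q (toEquiv x).2 = L.q x

theorem adjoint_baseChange {L M : EvenLattice} (f : L →ₗ[ℤ] M) (f' : M →ₗ[ℤ] L)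
    (h : ∀ x y, M.form (f x) y = L.form x (f' y)) (x : ℚ ⊗[ℤ] L) (y : M) :
    M.formQ (f.baseChange ℚ x) (M.toRat y) = L.formQ x (L.toRat (f' y)) := by
  induction x with
  | zero => simp
  | tmul a x => simp [toRat_apply, LinearMap.BilinForm.baseChange_tmul, h]
  | add a b ha hb => simp only [map_add, LinearMap.add_apply, ha, hb]

/-- The map `L^∨ → M^∨` induced by a linear map `f : L → M` that has an adjoint `M → L`.
Isometries and the inclusions of orthogonal direct summands are of this kind. -/
def dualMap {L M : EvenLattice} (f : L →ₗ[ℤ] M)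
    (h : ∃ f' : M →ₗ[ℤ] L, ∀ x y, M.form (f x) y = L.form x (f' y)) : L.dual →+ M.dual :=
  ((f.baseChange ℚ).toAddMonoidHom.comp L.dual.subtype).codRestrict M.dual (by
    rintro ⟨x, hx⟩ l
    obtain ⟨f', hf'⟩ := h
    obtain ⟨n, hn⟩ := hx (f' l)
    exact ⟨n, (adjoint_baseChange f f' hf' x l).trans hn⟩)

/-- The map `D(L) → D(M)` induced by a linear map `f : L → M` that has an adjoint. -/
def discMap {L M : EvenLattice} (f : L →ₗ[ℤ] M)
    (h : ∃ f' : M →ₗ[ℤ] L, ∀ x y, M.form (f x) y = L.form x (f' y)) : L.D →+ M.D :=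
  QuotientAddGroup.map _ _ (dualMap f h) (by
    rintro ⟨x, hx⟩ ⟨l, hl⟩
    have hl' : L.toRat l = x := hl
    subst hl'
    exact ⟨f l, (LinearMap.baseChange_tmul f (1 : ℚ) l).symm⟩)

/-- The inclusion `M → L ⊕ M` of the second summand. -/
def inrSum (L M : EvenLattice) : M →ₗ[ℤ] (L ⊞ M : EvenLattice) := LinearMap.inr ℤ L M

/-- The projection `L ⊕ M → M`. -/
def sndSum (L M : EvenLattice) : (L ⊞ M : EvenLattice) →ₗ[ℤ] M := LinearMap.snd ℤ L M

/-- The inclusion `D(M) → D(L ⊕ M)` of the second summand. -/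
def discInr (L M : EvenLattice) : M.D →+ (L ⊞ M).D :=
  discMap (inrSum L M) ⟨sndSum L M, fun x y => by
    change L.form 0 _ + M.form x _ = M.form x _
    rw [map_zero, LinearMap.zero_apply, zero_add]
    rfl⟩

/-! ### Orthogonal groups -/

/-- The orthogonal group as a subgroup of `GL(L)`. -/
def orthSubgroup (L : EvenLattice) : Subgroup (L ≃ₗ[ℤ] L) where
  carrier := {g | ∀ x y, L.form (g x) (g y) = L.form x y}
  mul_mem' := fun {a b} ha hb x y => by
    rw [LinearEquiv.mul_apply, LinearEquiv.mul_apply, ha, hb]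
  one_mem' := fun _ _ => rfl
  inv_mem' := fun {a} ha x y => by
    rw [← ha (a⁻¹ x) (a⁻¹ y)]
    simp

/-- The orthogonal group `O(L)`. -/
abbrev O (L : EvenLattice) : Type := L.orthSubgroup

/-- The action `g ↦ ḡ` of `O(L)` on the discriminant group. -/
def discAct (L : EvenLattice) : L.O →* AddMonoid.End L.D where
  toFun g := discMap (g.1 : L →ₗ[ℤ] L) ⟨(g.1.symm : L →ₗ[ℤ] L), fun x y => by
    have := g.2 x (g.1.symm y)
    simpa using this⟩
  map_one' := by
    ext ⟨x, hx⟩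
    refine congrArg (QuotientAddGroup.mk (s := L.toRat.range.addSubgroupOf L.dual))
      (Subtype.ext ?_)
    change (LinearMap.id : L →ₗ[ℤ] L).baseChange ℚ x = x
    rw [LinearMap.baseChange_id]
    rfl
  map_mul' := fun a b => by
    ext ⟨x, hx⟩
    refine congrArg (QuotientAddGroup.mk (s := L.toRat.range.addSubgroupOf L.dual))
      (Subtype.ext ?_)
    change ((a.1 : L →ₗ[ℤ] L) ∘ₗ (b.1 : L →ₗ[ℤ] L)).baseChange ℚ x = _
    rw [LinearMap.baseChange_comp]
    rfl

/-- The stable orthogonal group: the kernel of the action on the discriminant group. -/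
def stableO (L : EvenLattice) : Subgroup L.O := L.discAct.ker

/-- Complex conjugation on `L ⊗ ℂ`. -/
def conj (L : EvenLattice) : ℂ ⊗[ℤ] L →ₗ[ℤ] ℂ ⊗[ℤ] L :=
  LinearMap.rTensor L (starRingEnd ℂ).toAddMonoidHom.toIntLinearMap

/-- The projective space `ℙ(L ⊗ ℂ)`. -/
abbrev PC (L : EvenLattice) : Type := Projectivization ℂ (ℂ ⊗[ℤ] L)

/-- The usual topology on `ℙ(L ⊗ ℂ)`: the quotient of the topology of the finite-dimensional
complex vector space `L ⊗ ℂ` with the origin removed. -/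
instance (L : EvenLattice) : TopologicalSpace L.PC :=
  letI : TopologicalSpace (ℂ ⊗[ℤ] L) := moduleTopology ℂ (ℂ ⊗[ℤ] L)
  TopologicalSpace.coinduced (Projectivization.mk' (K := ℂ) (V := ℂ ⊗[ℤ] L)) inferInstance

/-- `Ω(L) = {[v] ∈ ℙ(L ⊗ ℂ) : (v, v) = 0, (v, v̄) > 0}`. -/
def Omega (L : EvenLattice) : Set L.PC :=
  {p | ∃ (v : ℂ ⊗[ℤ] L) (hv : v ≠ 0), p = Projectivization.mk ℂ v hv ∧
    L.form.baseChange ℂ v v = 0 ∧ 0 < (L.form.baseChange ℂ v (L.conj v)).re}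

/-- The action of `O(L)` on `ℙ(L ⊗ ℂ)`. -/
def projAct (L : EvenLattice) (g : L.O) : L.PC → L.PC :=
  Projectivization.map (g.1.baseChange ℤ ℂ L L).toLinearMap (g.1.baseChange ℤ ℂ L L).injective

theorem projAct_one (L : EvenLattice) (p : L.PC) : L.projAct 1 p = p := by
  induction p using Projectivization.ind with
  | h v hv =>
    rw [projAct, Projectivization.map_mk]
    congr 1
    change (LinearMap.id : L →ₗ[ℤ] L).baseChange ℂ v = v
    rw [LinearMap.baseChange_id]
    rfl

theorem projAct_mul (L : EvenLattice) (a b : L.O) (p : L.PC) :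
    L.projAct (a * b) p = L.projAct a (L.projAct b p) := by
  induction p using Projectivization.ind with
  | h v hv =>
    simp only [projAct, Projectivization.map_mk]
    congr 1
    change ((a.1 : L →ₗ[ℤ] L) ∘ₗ (b.1 : L →ₗ[ℤ] L)).baseChange ℂ v = _
    rw [LinearMap.baseChange_comp]
    rfl

theorem baseChange_isometry (L : EvenLattice) (g : L.O) (v w : ℂ ⊗[ℤ] L) :
    L.form.baseChange ℂ ((g.1 : L →ₗ[ℤ] L).baseChange ℂ v)
      ((g.1 : L →ₗ[ℤ] L).baseChange ℂ w) = L.form.baseChange ℂ v w := by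
  induction v with
  | zero => simp
  | add a b ha hb => simp only [map_add, LinearMap.add_apply, ha, hb]
  | tmul a x =>
    induction w with
    | zero => simp
    | add c d hc hd => simp only [map_add, hc, hd]
    | tmul c y =>
      have h := g.2 x y
      simp [LinearMap.BilinForm.baseChange_tmul, h]

theorem conj_baseChange (L : EvenLattice) (g : L.O) (v : ℂ ⊗[ℤ] L) :
    L.conj ((g.1 : L →ₗ[ℤ] L).baseChange ℂ v) =
      (g.1 : L →ₗ[ℤ] L).baseChange ℂ (L.conj v) := by
  induction v with
  | zero => simp
  | add a b ha hb => simp only [map_add, ha, hb]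
  | tmul a x => rfl

theorem projAct_mem (L : EvenLattice) (g : L.O) (p : L.PC) (hp : p ∈ L.Omega) :
    L.projAct g p ∈ L.Omega := by
  obtain ⟨v, hv, rfl, h0, h1⟩ := hp
  refine ⟨(g.1 : L →ₗ[ℤ] L).baseChange ℂ v,
    fun h => hv ((g.1.baseChange ℤ ℂ L L).injective (h.trans (map_zero _).symm)), rfl, ?_, ?_⟩
  · rw [baseChange_isometry, h0]
  · rw [conj_baseChange, baseChange_isometry]
    exact h1

/-- `O⁺(L)`: the isometries that map every connected component of `Ω(L)` to itself. -/
def Oplus (L : EvenLattice) : Subgroup L.O where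
  carrier := {g | ∀ p ∈ L.Omega, L.projAct g p ∈ connectedComponentIn L.Omega p}
  mul_mem' := fun {a b} ha hb p hp => by
    rw [projAct_mul, connectedComponentIn_eq (hb p hp)]
    exact ha _ (L.projAct_mem b p hp)
  one_mem' := fun p hp => by
    rw [projAct_one]
    exact mem_connectedComponentIn hp
  inv_mem' := fun {a} ha p hp => by
    have h := ha _ (L.projAct_mem a⁻¹ p hp)
    rw [← projAct_mul, mul_inv_cancel, projAct_one] at h
    rw [← connectedComponentIn_eq h]
    exact mem_connectedComponentIn (L.projAct_mem a⁻¹ p hp)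

/-- The intersection of the stable orthogonal group with `O⁺(L)`. -/
def stableOplus (L : EvenLattice) : Subgroup L.O := L.stableO ⊓ L.Oplus

/-- `O(L, h) = {g ∈ O(L) : g(h) = h}`. -/
def Ofix (L : EvenLattice) (h : L) : Subgroup L.O where
  carrier := {g | g.1 h = h}
  mul_mem' := fun {a b} (ha : a.1 h = h) (hb : b.1 h = h) => by
    change a.1 (b.1 h) = h
    rw [hb, ha]
  one_mem' := rfl
  inv_mem' := fun {a} (ha : a.1 h = h) => by
    change a.1.symm h = h
    rw [LinearEquiv.symm_apply_eq, ha]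

theorem Ofix_mem_perp (L : EvenLattice) (h : L) (g : L.Ofix h) (x : L)
    (hx : x ∈ LinearMap.ker (L.form h)) : g.1.1 x ∈ LinearMap.ker (L.form h) := by
  have h1 : g.1.1 h = h := g.2
  have h2 := g.1.2 h x
  rw [h1] at h2
  rw [LinearMap.mem_ker] at hx ⊢
  rw [h2, hx]

/-- Restriction of isometries `O(L, h) → O(L_h)`. -/
def restrictPerp (L : EvenLattice) (h : L) : L.Ofix h →* (L.perp h).O where
  toFun g := ⟨LinearEquiv.ofLinearMap
      (g.1.1.toLinearMap.restrict (L.Ofix_mem_perp h g))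
      ((g⁻¹).1.1.toLinearMap.restrict (L.Ofix_mem_perp h g⁻¹))
      (LinearMap.ext fun x => Subtype.ext (g.1.1.apply_symm_apply x.1))
      (LinearMap.ext fun x => Subtype.ext (g.1.1.symm_apply_apply x.1)),
    fun x y => g.1.2 x.1 y.1⟩
  map_one' := rfl
  map_mul' := fun _ _ => rfl

/-- `O⁺(L, h) = O(L, h) ∩ O⁺(L_h)`, as a subgroup of `O(L)`. -/
def OplusFix (L : EvenLattice) (h : L) : Subgroup L.O :=
  ((L.perp h).Oplus.comap (L.restrictPerp h)).map (L.Ofix h).subtype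

/-- The group of all `g ∈ O⁺(L ⊕ M)` whose action on `D(L ⊕ M)` is the identity on `D(M)`. -/
def OplusTrivialOnRight (L M : EvenLattice) : Subgroup (L ⊞ M).O where
  carrier := {g | g ∈ (L ⊞ M).Oplus ∧
    ∀ x : M.D, (L ⊞ M).discAct g (discInr L M x) = discInr L M x}
  mul_mem' := fun {a b} ha hb => ⟨mul_mem ha.1 hb.1, fun x => by
    rw [map_mul, AddMonoid.End.coe_mul, Function.comp_apply, hb.2, ha.2]⟩
  one_mem' := ⟨one_mem _, fun x => by rw [map_one, AddMonoid.End.coe_one, id]⟩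
  inv_mem' := fun {a} ha => ⟨inv_mem ha.1, fun x => by
    conv_lhs => rw [← ha.2 x]
    rw [← Function.comp_apply (f := (L ⊞ M).discAct a⁻¹), ← AddMonoid.End.coe_mul, ← map_mul,
      inv_mul_cancel, map_one, AddMonoid.End.coe_one, id]⟩

/-- `O_G(L_{A,2d})`: all `g ∈ O⁺(L_{A,2d})` that act trivially on `D(⟨-2d⟩)`. -/
def OG (d : ℕ) : Subgroup (LA2d d).O :=
  OplusTrivialOnRight (twoUtwoE8 (A2.rescale (-1))) (rankOne (-d))

end EvenLattice

end

/-! Everything follows from finding the orbit of `h`. Since `L_A` contains two orthogonal hyperbolic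
planes, Eichler transvections allow a Euclidean algorithm: `h` can be moved so that its product with
a standard isotropic vector `e` is positive and divides all its products, hence equals `div(h)`
(`IsHyperbolicFrame.exists_dvd`). Write `L_A = U ⊕ M`, where `M` is unimodular apart from the
summand `A₂(-1)`, whose discriminant group is killed by 3. Primitivity leaves only `div(h) ∈ {1,
3}`, and transvections along `e` reduce the `M`-component modulo `div(h)`. With `h² = 2d` this gives
the normal forms of `exists_normalForm`: `d e + f` for divisor 1, and `3k e + 3f + (a₁ - a₂)` with
`d = 9k - 3` for divisor 3.

Orthogonal complements of these two vectors are explicit. The first is `M ⊕ ⟨-2d⟩`, the last summand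
being spanned by `-d e + f`; the second is `2U ⊕ 2E₈(-1) ⊕ Q(-1)` for a ternary lattice of
determinant `6k - 2 = 2d/3` with cyclic discriminant group. Orthogonal frames give the signatures,
and unimodular summands disappear from the discriminant forms.

For the groups, put `P x = (h,h) x - (h,x) h`. An isometry of `h^⊥` extends to `L_A` with `h` fixed
exactly when it fixes all classes `P x / (h,h)` in `D(h^⊥)`; cleared of denominators, this is
`FixesProj`. For divisor 3 an order count shows that one such class generates `D(h^⊥)`, so the
condition is stability (`fixesProj_iff_of_card`). For divisor 1 the classes are the multiples of the
generator of `D(⟨-2d⟩)`, so the condition is that of `O_G` (`fixesProj_iff_fixes_discInr`).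

Finally, the form on `D(A₂(-1))` has no nonzero isotropic element, so a totally isotropic subgroup
of `D(A₂(-1)) ⊕ D(⟨-2d⟩)` embeds into the cyclic group `D(⟨-2d⟩)`. -/

noncomputable section

namespace EvenLattice

/-! ### Fractions in `L ⊗ ℚ` -/

section Fractions

variable {L M : EvenLattice}

/-- The element `m / β` of `L ⊗ ℚ`. -/
def frac (L : EvenLattice) (β : ℤ) (m : L) : ℚ ⊗[ℤ] L := ((β : ℚ)⁻¹) ⊗ₜ[ℤ] m

theorem frac_mul_smul {c : ℤ} (hc : c ≠ 0) (β : ℤ) (m : L) :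
    L.frac (c * β) (c • m) = L.frac β m := by
  have hc' : (c : ℚ) ≠ 0 := by exact_mod_cast hc
  rw [frac, frac, ← TensorProduct.smul_tmul]
  congr 1
  rw [zsmul_eq_mul]
  push_cast
  rw [mul_inv, ← mul_assoc, mul_inv_cancel₀ hc', one_mul]

theorem frac_zero (β : ℤ) : L.frac β 0 = 0 := TensorProduct.tmul_zero _ _

theorem frac_add (β : ℤ) (m n : L) : L.frac β (m + n) = L.frac β m + L.frac β n :=
  TensorProduct.tmul_add _ _ _

theorem frac_sub (β : ℤ) (m n : L) : L.frac β (m - n) = L.frac β m - L.frac β n :=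
  TensorProduct.tmul_sub _ _ _

theorem frac_smul (β c : ℤ) (m : L) : L.frac β (c • m) = c • L.frac β m :=
  TensorProduct.tmul_smul _ _ _

theorem frac_self_smul {β : ℤ} (hβ : β ≠ 0) (m : L) : L.frac β (β • m) = L.toRat m := by
  have h := frac_mul_smul hβ 1 m
  rw [mul_one] at h
  rw [h, frac, toRat_apply]
  simp

theorem exists_frac (y : ℚ ⊗[ℤ] L) : ∃ (β : ℤ) (m : L), β ≠ 0 ∧ y = L.frac β m := by
  induction y with
  | zero => exact ⟨1, 0, one_ne_zero, by simp [frac]⟩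
  | tmul a x =>
    refine ⟨a.den, a.num • x, by exact_mod_cast a.den_nz, ?_⟩
    rw [frac, ← TensorProduct.smul_tmul]
    congr 1
    rw [zsmul_eq_mul]
    push_cast
    rw [← div_eq_mul_inv, Rat.num_div_den]
  | add a b ha hb =>
    obtain ⟨β, m, hβ, rfl⟩ := ha
    obtain ⟨γ, n, hγ, rfl⟩ := hb
    refine ⟨γ * β, γ • m + β • n, mul_ne_zero hγ hβ, ?_⟩
    rw [frac_add, frac_mul_smul hγ, mul_comm, frac_mul_smul hβ]

theorem toRat_injective : Function.Injective L.toRat :=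
  (Module.Flat.rTensor_preserves_injective_linearMap (M := L) (Algebra.linearMap ℤ ℚ)
    (fun a b h => Int.cast_injective (α := ℚ) h)).comp
      (TensorProduct.lid ℤ L).symm.injective |> fun h => by
      intro x y hxy
      apply h
      simpa [toRat_apply] using hxy

theorem frac_eq_toRat_iff {β : ℤ} (hβ : β ≠ 0) (m l : L) :
    L.frac β m = L.toRat l ↔ m = β • l := by
  constructor
  · intro h
    apply toRat_injective
    rw [← frac_self_smul hβ m, frac_smul, h, map_zsmul]
  · rintro rfl
    exact frac_self_smul hβ l

theorem formQ_frac_frac (β γ : ℤ) (m n : L) :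
    L.formQ (L.frac β m) (L.frac γ n) = (L.form m n : ℚ) / (β * γ) := by
  simp only [formQ, frac, LinearMap.BilinForm.baseChange_tmul, zsmul_eq_mul]
  rw [div_eq_mul_inv, mul_inv]

theorem formQ_frac_toRat (β : ℤ) (m l : L) :
    L.formQ (L.frac β m) (L.toRat l) = (L.form m l : ℚ) / β := by
  have h := formQ_frac_frac β 1 m l
  simpa [frac, toRat_apply] using h

/-- Turns every question about `L^∨` and `D(L)` into divisibility of integers; together with
`exists_frac` it removes tensor products from the later arguments. -/
theorem frac_mem_dual {β : ℤ} (hβ : β ≠ 0) (m : L) :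
    L.frac β m ∈ L.dual ↔ ∀ l, β ∣ L.form m l := by
  have hβ' : (β : ℚ) ≠ 0 := by exact_mod_cast hβ
  change (∀ l : L, ∃ n : ℤ, L.formQ (L.frac β m) (L.toRat l) = n) ↔ _
  refine forall_congr' fun l => exists_congr fun n => ?_
  rw [formQ_frac_toRat, div_eq_iff hβ', mul_comm]
  norm_cast

theorem baseChange_frac (f : L →ₗ[ℤ] M) (β : ℤ) (m : L) :
    f.baseChange ℚ (L.frac β m) = M.frac β (f m) := rfl

end Fractions

/-! ### The discriminant group -/

section Discriminant

variable {L M N : EvenLattice}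

/-- The quotient map `L^∨ → D(L)`. -/
def toD (L : EvenLattice) : L.dual →+ L.D := QuotientAddGroup.mk' _

theorem toD_surjective : Function.Surjective L.toD := QuotientAddGroup.mk'_surjective _

theorem toD_eq_zero (y : L.dual) : L.toD y = 0 ↔ ∃ l : L, L.toRat l = y :=
  QuotientAddGroup.eq_zero_iff y

theorem toD_eq_iff (x y : L.dual) :
    L.toD x = L.toD y ↔ ∃ l : L, L.toRat l = (x : ℚ ⊗[ℤ] L) - y := by
  rw [← sub_eq_zero, ← map_sub, toD_eq_zero]
  rfl

theorem q_toD_eq_zero (y : L.dual) :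
    L.q (L.toD y) = 0 ↔ ∃ k : ℤ, L.formQ (y : ℚ ⊗[ℤ] L) y = 2 * k := by
  change ((L.formQ (y : ℚ ⊗[ℤ] L) y : ℚ) : ℚ ⧸ AddSubgroup.zmultiples (2 : ℚ)) = 0 ↔ _
  rw [QuotientAddGroup.eq_zero_iff, AddSubgroup.mem_zmultiples_iff]
  refine exists_congr fun k => ?_
  rw [zsmul_eq_mul, mul_comm, eq_comm]

theorem q_toD (y : L.dual) :
    L.q (L.toD y) = ((L.formQ (y : ℚ ⊗[ℤ] L) y : ℚ) : ℚ ⧸ AddSubgroup.zmultiples (2 : ℚ)) := rfl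

theorem q_zero : L.q 0 = 0 := by
  rw [← map_zero L.toD, q_toD_eq_zero]
  exact ⟨0, by simp⟩

theorem discMap_toD (f : L →ₗ[ℤ] M) (h) (y : L.dual) :
    discMap f h (L.toD y) = M.toD (dualMap f h y) := rfl

theorem coe_dualMap (f : L →ₗ[ℤ] M) (h) (y : L.dual) :
    (dualMap f h y : ℚ ⊗[ℤ] M) = f.baseChange ℚ (y : ℚ ⊗[ℤ] L) := rfl

theorem exists_eq_toD (x : L.D) : ∃ (β : ℤ) (m : L) (hβ : β ≠ 0) (hm : ∀ l, β ∣ L.form m l),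
    x = L.toD ⟨L.frac β m, (frac_mem_dual hβ m).2 hm⟩ := by
  obtain ⟨⟨y, hy⟩, rfl⟩ := toD_surjective x
  obtain ⟨β, m, hβ, rfl⟩ := exists_frac y
  exact ⟨β, m, hβ, (frac_mem_dual hβ m).1 hy, rfl⟩

theorem toD_frac_eq_zero {β : ℤ} (hβ : β ≠ 0) (m : L) (h) :
    L.toD ⟨L.frac β m, h⟩ = 0 ↔ ∃ l : L, m = β • l := by
  rw [toD_eq_zero]
  refine exists_congr fun l => ?_
  rw [← frac_eq_toRat_iff hβ, eq_comm]

theorem formQ_isometry {f : L →ₗ[ℤ] M} (hf : ∀ x y, M.form (f x) (f y) = L.form x y)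
    (x y : ℚ ⊗[ℤ] L) : M.formQ (f.baseChange ℚ x) (f.baseChange ℚ y) = L.formQ x y := by
  obtain ⟨β, m, -, rfl⟩ := exists_frac x
  obtain ⟨γ, n, -, rfl⟩ := exists_frac y
  rw [baseChange_frac, baseChange_frac, formQ_frac_frac, formQ_frac_frac, hf]

/-- The inverse of an isometry is its adjoint, which is what `discMap` requires. -/
theorem IsometryEquiv.adjoint (e : L.form.IsometryEquiv M.form) :
    ∃ f' : M →ₗ[ℤ] L, ∀ x y, M.form (e.toLinearEquiv.toLinearMap x) y = L.form x (f' y) :=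
  ⟨e.toLinearEquiv.symm, fun x y => by
    have := e.map_app (e.toLinearEquiv.symm y) x
    rw [← LinearMap.BilinForm.IsometryEquiv.coe_toLinearEquiv] at this
    simpa using this⟩

/-- The isomorphism of discriminant groups induced by an isometry. -/
def DiscIso.ofIsometry (e : L.form.IsometryEquiv M.form) : DiscIso L M where
  toEquiv := AddMonoidHom.toAddEquiv
    (discMap e.toLinearEquiv.toLinearMap (IsometryEquiv.adjoint e))
    (discMap e.symm.toLinearEquiv.toLinearMap (IsometryEquiv.adjoint e.symm))
    (by
      refine DFunLike.ext _ _ fun x => ?_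
      obtain ⟨β, m, hβ, hm, rfl⟩ := exists_eq_toD x
      rw [AddMonoidHom.comp_apply, discMap_toD, discMap_toD]
      refine congrArg (toD _) (Subtype.ext ?_)
      rw [coe_dualMap, coe_dualMap, baseChange_frac, baseChange_frac]
      exact congrArg _ (e.toLinearEquiv.symm_apply_apply m))
    (by
      refine DFunLike.ext _ _ fun x => ?_
      obtain ⟨β, m, hβ, hm, rfl⟩ := exists_eq_toD x
      rw [AddMonoidHom.comp_apply, discMap_toD, discMap_toD]
      refine congrArg (toD _) (Subtype.ext ?_)
      rw [coe_dualMap, coe_dualMap, baseChange_frac, baseChange_frac]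
      exact congrArg _ (e.toLinearEquiv.apply_symm_apply m))
  map_q x := by
    obtain ⟨y, rfl⟩ := toD_surjective x
    change M.q (discMap _ _ (L.toD y)) = _
    rw [discMap_toD, q_toD, q_toD, coe_dualMap, formQ_isometry]
    exact fun x y => e.map_app _ _

/-- Composition of isomorphisms of discriminant forms. -/
def DiscIso.trans (e : DiscIso L M) (f : DiscIso M N) : DiscIso L N where
  toEquiv := e.toEquiv.trans f.toEquiv
  map_q x := by rw [AddEquiv.trans_apply, f.map_q, e.map_q]

/-- The inverse of an isomorphism of discriminant forms. -/
def DiscIso.symm (e : DiscIso L M) : DiscIso M L where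
  toEquiv := e.toEquiv.symm
  map_q x := by rw [← e.map_q, AddEquiv.apply_symm_apply]

end Discriminant

/-! ### Orthogonal sums -/

section Sums

variable {L M N : EvenLattice}

/-- The inclusion `L → L ⊕ M` of the first summand. -/
def inlSum (L M : EvenLattice) : L →ₗ[ℤ] (L ⊞ M : EvenLattice) := LinearMap.inl ℤ L M

/-- The projection `L ⊕ M → L`. -/
def fstSum (L M : EvenLattice) : (L ⊞ M : EvenLattice) →ₗ[ℤ] L := LinearMap.fst ℤ L M

theorem form_sum (x y : (L ⊞ M : EvenLattice)) :
    (L ⊞ M).form x y = L.form (fstSum L M x) (fstSum L M y) +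
      M.form (sndSum L M x) (sndSum L M y) := rfl

theorem fst_inl (x : L) : fstSum L M (inlSum L M x) = x := rfl
theorem snd_inl (x : L) : sndSum L M (inlSum L M x) = 0 := rfl
theorem fst_inr (x : M) : fstSum L M (inrSum L M x) = 0 := rfl
theorem snd_inr (x : M) : sndSum L M (inrSum L M x) = x := rfl

theorem inl_fst_add_inr_snd (x : (L ⊞ M : EvenLattice)) :
    inlSum L M (fstSum L M x) + inrSum L M (sndSum L M x) = x :=
  Prod.ext (add_zero (M := L) _) (zero_add (M := M) _)

theorem sum_ext {x y : (L ⊞ M : EvenLattice)} (h1 : fstSum L M x = fstSum L M y)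
    (h2 : sndSum L M x = sndSum L M y) : x = y := Prod.ext h1 h2

theorem form_inl_left (x : L) (y : (L ⊞ M : EvenLattice)) :
    (L ⊞ M).form (inlSum L M x) y = L.form x (fstSum L M y) := by
  rw [form_sum, fst_inl, snd_inl, map_zero, LinearMap.zero_apply, add_zero]

theorem form_inr_left (x : M) (y : (L ⊞ M : EvenLattice)) :
    (L ⊞ M).form (inrSum L M x) y = M.form x (sndSum L M y) := by
  rw [form_sum, fst_inr, snd_inr, map_zero, LinearMap.zero_apply, zero_add]

theorem form_fst_left (x : (L ⊞ M : EvenLattice)) (y : L) :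
    L.form (fstSum L M x) y = (L ⊞ M).form x (inlSum L M y) := by
  rw [form_sum, fst_inl, snd_inl, map_zero, add_zero]

theorem form_snd_left (x : (L ⊞ M : EvenLattice)) (y : M) :
    M.form (sndSum L M x) y = (L ⊞ M).form x (inrSum L M y) := by
  rw [form_sum, fst_inr, snd_inr, map_zero, zero_add]

/-- `D(L ⊕ M) ≅ D(L) ⊕ D(M)`. -/
def DiscSumIso.sum (L M : EvenLattice) : DiscSumIso (L ⊞ M) L M where
  toEquiv := AddMonoidHom.toAddEquiv
    ((discMap (fstSum L M) ⟨inlSum L M, form_fst_left⟩).prod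
      (discMap (sndSum L M) ⟨inrSum L M, form_snd_left⟩))
    ((discMap (inlSum L M) ⟨fstSum L M, form_inl_left⟩).coprod
      (discMap (inrSum L M) ⟨sndSum L M, form_inr_left⟩))
    (by
      refine DFunLike.ext _ _ fun x => ?_
      obtain ⟨β, m, hβ, hm, rfl⟩ := exists_eq_toD x
      simp only [AddMonoidHom.comp_apply, AddMonoidHom.prod_apply, AddMonoidHom.coprod_apply,
        discMap_toD, ← map_add, AddMonoidHom.id_apply]
      congr 1
      apply Subtype.ext
      simp only [AddSubgroup.coe_add, coe_dualMap, baseChange_frac, ← frac_add,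
        inl_fst_add_inr_snd])
    (by
      refine DFunLike.ext _ _ fun x => ?_
      obtain ⟨x, y⟩ := x
      obtain ⟨β, m, hβ, hm, rfl⟩ := exists_eq_toD x
      obtain ⟨γ, n, hγ, hn, rfl⟩ := exists_eq_toD y
      simp only [AddMonoidHom.comp_apply, AddMonoidHom.prod_apply, AddMonoidHom.coprod_apply,
        discMap_toD, ← map_add, AddMonoidHom.id_apply]
      congr 2 <;> apply Subtype.ext <;>
      simp only [AddSubgroup.coe_add, coe_dualMap, baseChange_frac, map_add, fst_inl, snd_inl,
        fst_inr, snd_inr, frac_zero, add_zero, zero_add])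
  map_q x := by
    obtain ⟨β, m, hβ, hm, rfl⟩ := exists_eq_toD x
    change L.q (discMap _ _ (toD _ _)) + M.q (discMap _ _ (toD _ _)) = _
    rw [discMap_toD, discMap_toD, q_toD, q_toD, q_toD, ← QuotientAddGroup.mk_add]
    congr 1
    simp only [coe_dualMap, baseChange_frac, formQ_frac_frac, form_sum]
    push_cast
    ring

/-- Transport of a decomposition of the discriminant form along isomorphisms. -/
def DiscSumIso.congr {L' M' N' : EvenLattice} (s : DiscSumIso L M N) (e : DiscIso L' L)
    (f : DiscIso M M') (g : DiscIso N N') : DiscSumIso L' M' N' where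
  toEquiv := (e.toEquiv.trans s.toEquiv).trans (f.toEquiv.prodCongr g.toEquiv)
  map_q x := by
    rw [← e.map_q, ← s.map_q, ← f.map_q, ← g.map_q]
    rfl

/-- The identity isomorphism. -/
def DiscIso.refl (L : EvenLattice) : DiscIso L L := ⟨AddEquiv.refl _, fun _ => rfl⟩

/-- A lattice is unimodular if every vector whose products are all divisible by `β` is a multiple
of `β`. -/
def IsUnimodular (L : EvenLattice) : Prop :=
  ∀ (β : ℤ) (m : L), β ≠ 0 → (∀ l, β ∣ L.form m l) → ∃ m' : L, m = β • m'

theorem IsUnimodular.rescale_neg_one (hL : L.IsUnimodular) : (L.rescale (-1)).IsUnimodular := by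
  intro β m hβ hm
  refine hL β m hβ fun l => ?_
  have h : β ∣ (-1) * L.form m l := hm l
  rwa [neg_one_mul, dvd_neg] at h

theorem IsUnimodular.subsingleton (hL : L.IsUnimodular) : Subsingleton L.D := by
  refine subsingleton_of_forall_eq 0 fun x => ?_
  obtain ⟨β, m, hβ, hm, rfl⟩ := exists_eq_toD x
  rw [toD_frac_eq_zero hβ]
  exact hL β m hβ hm

/-- A unimodular summand does not contribute to the discriminant form. -/
def DiscIso.unimodularSum (hL : L.IsUnimodular) (M : EvenLattice) : DiscIso (L ⊞ M) M where
  toEquiv :=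
    haveI := hL.subsingleton
    haveI : Unique L.D := Unique.mk' _
    (DiscSumIso.sum L M).toEquiv.trans AddEquiv.uniqueProd
  map_q x := by
    have h := (DiscSumIso.sum L M).map_q x
    have h0 : ((DiscSumIso.sum L M).toEquiv x).1 = 0 := hL.subsingleton.elim _ _
    rw [h0, q_zero, zero_add] at h
    exact h

/-- Testing against the basis vectors gives `m G = β w`, and `G⁻¹` is integral, so `m = β (w G⁻¹)`.
-/
theorem isUnimodular_ofGram {n : ℕ} (G : Matrix (Fin n) (Fin n) ℤ) (hs : G.IsSymm)
    (he : ∀ i, Even (G i i)) (hG : IsUnit G.det) : (ofGram G hs he).IsUnimodular := by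
  intro β (m : Fin n → ℤ) hβ hm
  have h1 : ∀ i, ∃ w, (Matrix.vecMul m G) i = β * w := fun i => by
    obtain ⟨w, hw⟩ := hm (Pi.single i 1 : Fin n → ℤ)
    refine ⟨w, ?_⟩
    rw [← hw]
    change _ = Matrix.toBilin' G m (Pi.single i 1)
    rw [Matrix.toBilin'_apply', Matrix.dotProduct_mulVec]
    simp
  choose w hw using h1
  refine ⟨(Matrix.vecMul w G⁻¹ : Fin n → ℤ), ?_⟩
  have h2 : Matrix.vecMul m G = β • w := funext hw
  change m = β • Matrix.vecMul w G⁻¹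
  rw [← Matrix.smul_vecMul, ← h2, Matrix.vecMul_vecMul, Matrix.mul_nonsing_inv _ hG,
    Matrix.vecMul_one]

theorem isUnimodular_U : U.IsUnimodular :=
  isUnimodular_ofGram _ _ _ (by simp [Matrix.det_fin_two])

theorem isUnimodular_E8 : E8.IsUnimodular :=
  isUnimodular_ofGram _ _ _ (by rw [CartanMatrix.E₈_det]; exact isUnit_one)

/-- The lattice `2U ⊕ 2E₈(-1) ⊕ S` has the discriminant form of `S`. -/
def DiscIso.twoUtwoE8 (S : EvenLattice) : DiscIso (twoUtwoE8 S) S :=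
  (((DiscIso.unimodularSum isUnimodular_U _).trans
    (DiscIso.unimodularSum isUnimodular_U _)).trans
    (DiscIso.unimodularSum isUnimodular_E8.rescale_neg_one _)).trans
    (DiscIso.unimodularSum isUnimodular_E8.rescale_neg_one _)

end Sums

/-! ### Eichler transvections -/

section Eichler

variable {L M N : EvenLattice}

/-- The linear map `x ↦ x - (a, x) c + (c, x) a - k (c, x) c`. -/
def transvection (c a : L) (k : ℤ) : L →ₗ[ℤ] L :=
  LinearMap.id - (L.form a).smulRight c + (L.form c).smulRight a -
    k • (L.form c).smulRight c

theorem transvection_apply (c a : L) (k : ℤ) (x : L) :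
    transvection c a k x = x - L.form a x • c + L.form c x • a - k • L.form c x • c := rfl

theorem transvection_neg_apply {c a : L} {k : ℤ} (hc : L.form c c = 0) (hca : L.form c a = 0)
    (hk : L.form a a = 2 * k) (x : L) : transvection c a k (transvection c (-a) k x) = x := by
  have hac : L.form a c = 0 := by rw [L.symm, hca]
  simp only [transvection_apply, map_add, map_sub, map_smul, map_neg, LinearMap.neg_apply, hc, hca,
    hac, hk]
  module

/-- The terms linear in `a` cancel by antisymmetry, and the two terms with `-k` cancel the
contribution `(a,a)(c,x)(c,y) = 2k (c,x)(c,y)`. -/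
theorem form_transvection {c a : L} {k : ℤ} (hc : L.form c c = 0) (hca : L.form c a = 0)
    (hk : L.form a a = 2 * k) (x y : L) :
    L.form (transvection c a k x) (transvection c a k y) = L.form x y := by
  have hac : L.form a c = 0 := by rw [L.symm, hca]
  simp only [transvection_apply, map_add, map_sub, map_smul, LinearMap.add_apply,
    LinearMap.sub_apply, LinearMap.smul_apply, hc, hca, hac, hk, smul_eq_mul, L.symm x c, L.symm x a]
  ring

theorem exists_transvection {c a : L} (hc : L.form c c = 0) (hca : L.form c a = 0) :
    ∃ (g : L.O) (k : ℤ), L.form a a = 2 * k ∧ ∀ x, g.1 x = transvection c a k x := by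
  obtain ⟨k, hk⟩ := L.even a
  rw [← two_mul] at hk
  have hk' : L.form (-a) (-a) = 2 * k := by simpa using hk
  have hca' : L.form c (-a) = 0 := by simpa using hca
  have h := fun x => transvection_neg_apply (a := -a) hc hca' hk' x
  simp only [neg_neg] at h
  exact ⟨⟨LinearEquiv.ofLinearMap (transvection c a k) (transvection c (-a) k)
    (LinearMap.ext (transvection_neg_apply hc hca hk)) (LinearMap.ext h),
    form_transvection hc hca hk⟩, k, hk, fun _ => rfl⟩

/-- The reduction arguments below only track products with fixed vectors, so transvections are used
through this formula. -/
theorem exists_transvection_form {c a : L} (hc : L.form c c = 0) (hca : L.form c a = 0) :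
    ∃ (g : L.O) (k : ℤ), L.form a a = 2 * k ∧ ∀ x y, L.form (g.1 x) y =
      L.form x y - L.form x a * L.form c y + L.form x c * L.form a y -
        k * (L.form x c * L.form c y) := by
  obtain ⟨g, k, hk, hg⟩ := exists_transvection hc hca
  refine ⟨g, k, hk, fun x y => ?_⟩
  rw [hg, transvection_apply]
  simp only [map_add, map_sub, map_smul, LinearMap.add_apply, LinearMap.sub_apply,
    LinearMap.smul_apply, smul_eq_mul, L.symm c x, L.symm a x]

/-- The isometry `-1`. -/
def negO (L : EvenLattice) : L.O :=
  ⟨LinearEquiv.neg ℤ, fun x y => by simp⟩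

/-- A hyperbolic pair. -/
structure IsHyperbolicPair (e f : L) : Prop where
  left : L.form e e = 0
  right : L.form f f = 0
  pair : L.form e f = 1

theorem IsHyperbolicPair.swap {e f : L} (h : IsHyperbolicPair e f) : IsHyperbolicPair f e :=
  ⟨h.right, h.left, by rw [L.symm, h.pair]⟩

/-- Two orthogonal hyperbolic pairs. -/
structure IsHyperbolicFrame (e f e' f' : L) : Prop where
  fst : IsHyperbolicPair e f
  snd : IsHyperbolicPair e' f'
  ee : L.form e e' = 0
  ef : L.form e f' = 0
  fe : L.form f e' = 0
  ff : L.form f f' = 0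

theorem IsHyperbolicFrame.swap {e f e' f' : L} (h : IsHyperbolicFrame e f e' f') :
    IsHyperbolicFrame e f f' e' := ⟨h.fst, h.snd.swap, h.ef, h.ee, h.ff, h.fe⟩

/-- If the whole orbit of `v` were orthogonal to `e`, transvections along `f` would give a linear
relation for every `a ⊥ f`. The choices `e'`, `f'` and `e' + f'` successively force `(v,e') = (v,f')
= (v,f) = 0`; then `v` is orthogonal to `f^⊥` and to `f`, hence to everything. -/
theorem IsHyperbolicFrame.exists_form_ne_zero {e f e' f' : L} (F : IsHyperbolicFrame e f e' f')
    (v y : L) (hy : L.form v y ≠ 0) : ∃ g : L.O, L.form (g.1 v) e ≠ 0 := by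
  by_contra! H
  have h0 : L.form v e = 0 := H 1
  have hfe : L.form f e = 1 := F.fst.swap.pair
  have key : ∀ a k, L.form f a = 0 → L.form a a = 2 * k →
      - L.form v a + L.form v f * L.form a e - k * L.form v f = 0 := by
    intro a k ha hk
    obtain ⟨g, k', hk', hg⟩ := exists_transvection_form F.fst.right ha
    have h1 := H g
    have : k' = k := by lia
    rw [hg, h0, hfe, this] at h1
    linarith
  have he'e : L.form e' e = 0 := by rw [L.symm, F.ee]
  have hf'e : L.form f' e = 0 := by rw [L.symm, F.ef]
  have h1 : L.form v e' = 0 := by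
    have := key e' 0 F.fe F.snd.left
    rw [he'e] at this
    linarith
  have h2 : L.form v f' = 0 := by
    have := key f' 0 F.ff F.snd.right
    rw [hf'e] at this
    linarith
  -- Here `(e' + f')² = 2`, so the quadratic term of the transvection survives and isolates `(v,f)`.
  have h3 : L.form v f = 0 := by
    have := key (e' + f') 1 (by simp [F.fe, F.ff])
      (by simp [F.snd.left, F.snd.right, F.snd.pair, F.snd.swap.pair])
    simp only [map_add, h1, h2, LinearMap.add_apply, he'e, hf'e] at this
    linarith
  -- This vector is orthogonal to `f`, and subtracting a multiple of `e` does not change the product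
  -- with `v`.
  obtain ⟨k, hk⟩ := L.even (y - L.form y f • e)
  have := key (y - L.form y f • e) k (by simp [hfe, L.symm f y]) (by rw [hk, two_mul])
  simp only [map_sub, map_smul, h0, h3, smul_eq_mul] at this
  apply hy
  linarith

/-- The vector `v` has minimal positive product with `e` in its orbit. -/
def IsOrbitMinimal (e v : L) : Prop :=
  0 < L.form v e ∧ ∀ g : L.O, 0 < L.form (g.1 v) e → L.form v e ≤ L.form (g.1 v) e

theorem IsOrbitMinimal.of_eq {e v : L} (hv : IsOrbitMinimal e v) (g : L.O)
    (hg : L.form (g.1 v) e = L.form v e) : IsOrbitMinimal e (g.1 v) :=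
  ⟨hg ▸ hv.1, fun g' hg' => by rw [hg]; exact hv.2 (g' * g) hg'⟩

/-- The isometry `-1` makes a nonzero product positive, and then a least positive one exists. -/
theorem exists_isOrbitMinimal (e v : L) (h : ∃ g : L.O, L.form (g.1 v) e ≠ 0) :
    ∃ g : L.O, IsOrbitMinimal e (g.1 v) := by
  classical
  have hex : ∃ n : ℕ, 0 < n ∧ ∃ g : L.O, L.form (g.1 v) e = n := by
    obtain ⟨g, hg⟩ := h
    rcases lt_or_gt_of_ne hg with h1 | h1
    · refine ⟨(-L.form (g.1 v) e).toNat, by lia, negO L * g, ?_⟩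
      change L.form (-(g.1 v)) e = _
      rw [map_neg, LinearMap.neg_apply]
      lia
    · exact ⟨(L.form (g.1 v) e).toNat, by lia, g, by lia⟩
  obtain ⟨hpos, g, hg⟩ := Nat.find_spec hex
  refine ⟨g, by lia, fun g' hg' => ?_⟩
  rw [hg]
  have h2 : L.form (g'.1 (g.1 v)) e = ((L.form (g'.1 (g.1 v)) e).toNat : ℤ) := by lia
  have := Nat.find_min' hex (m := (L.form (g'.1 (g.1 v)) e).toNat) ⟨by lia, g' * g, h2⟩
  lia

/-- Reduction of `(v, e')` modulo `(v, e)`. -/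
theorem IsHyperbolicFrame.exists_reduce {e f e' f' : L} (F : IsHyperbolicFrame e f e' f')
    (v : L) (s : ℤ) : ∃ g : L.O, L.form (g.1 v) e = L.form v e ∧
      L.form (g.1 v) e' = L.form v e' + s * L.form v e := by
  obtain ⟨g, k, hk, hg⟩ := exists_transvection_form (c := e) (a := s • f') F.fst.left
    (by simp [F.ef])
  refine ⟨g, ?_, ?_⟩
  · rw [hg]
    simp [F.fst.left, L.symm f' e, F.ef]
  · rw [hg]
    simp [F.ee, F.snd.swap.pair]
    ring

/-- A Euclidean step. After `(v,e')` is replaced by its remainder `r` modulo `(v,e)`, the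
transvection along `e'` by `-f` changes `(v,e)` to `(v,e) - r`, which is still positive; minimality
forces `r = 0`. -/
theorem IsHyperbolicFrame.dvd_of_minimal {e f e' f' : L} (F : IsHyperbolicFrame e f e' f')
    {v : L} (hv : IsOrbitMinimal e v) : L.form v e ∣ L.form v e' := by
  obtain ⟨g, hg1, hg2⟩ := F.exists_reduce v (-(L.form v e' / L.form v e))
  have hr : L.form (g.1 v) e' = L.form v e' % L.form v e := by
    rw [hg2, Int.emod_def]; ring
  have hw := hv.of_eq g hg1
  obtain ⟨g', k, hk, hg'⟩ := exists_transvection_form (c := e') (a := -f) F.snd.left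
    (by simp [L.symm e' f, F.fe])
  have h1 : L.form (g'.1 (g.1 v)) e = L.form v e - L.form v e' % L.form v e := by
    rw [hg', hg1, hr]
    simp [L.symm e' e, F.ee, F.fst.swap.pair]
    ring
  have h2 := hv.2 (g' * g)
  change 0 < L.form (g'.1 (g.1 v)) e → _ ≤ L.form (g'.1 (g.1 v)) e at h2
  rw [h1] at h2
  have h3 := Int.emod_lt_of_pos (L.form v e') hv.1
  have h4 := Int.emod_nonneg (L.form v e') hv.1.ne'
  exact Int.dvd_of_emod_eq_zero (by have := h2 (by linarith); linarith)

/-- A vector whose product with `e` is minimal in its orbit can be moved so that this product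
divides all products. -/
theorem IsHyperbolicFrame.exists_dvd {e f e' f' : L} (F : IsHyperbolicFrame e f e' f')
    (v y : L) (hy : L.form v y ≠ 0) :
    ∃ g : L.O, 0 < L.form (g.1 v) e ∧ ∀ z, L.form (g.1 v) e ∣ L.form (g.1 v) z := by
  obtain ⟨g₀, hg₀⟩ := exists_isOrbitMinimal e v (F.exists_form_ne_zero v y hy)
  obtain ⟨w₀, hw₀⟩ : ∃ w, w = g₀.1 v := ⟨_, rfl⟩
  rw [← hw₀] at hg₀
  obtain ⟨q, hq⟩ := F.dvd_of_minimal hg₀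
  obtain ⟨g₁, h1, h2⟩ := F.exists_reduce w₀ (-q)
  refine ⟨g₁ * g₀, ?_⟩
  change 0 < L.form (g₁.1 (g₀.1 v)) e ∧ ∀ z, L.form (g₁.1 (g₀.1 v)) e ∣ L.form (g₁.1 (g₀.1 v)) z
  rw [← hw₀]
  have hw := hg₀.of_eq g₁ h1
  obtain ⟨w, hw'⟩ : ∃ w, w = g₁.1 w₀ := ⟨_, rfl⟩
  have h3 : L.form w e' = 0 := by rw [hw', h2, hq]; ring
  rw [← hw'] at hw ⊢
  refine ⟨hw.1, ?_⟩
  -- Because `(w,e') = 0`, the transvection along `e'` by `a` preserves `(w,e)` and changes `(w,f')`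
  -- by `-(w,a)`. Both vectors are minimal, so `(w,e)` divides `(w,f')` before and after.
  have key : ∀ a, L.form e' a = 0 → L.form w e ∣ L.form w a := by
    intro a ha
    obtain ⟨g, k, hk, hg⟩ := exists_transvection_form F.snd.left ha
    have h4 : L.form (g.1 w) e = L.form w e := by
      rw [hg, h3, L.symm e' e, F.ee]; ring
    have h5 : L.form (g.1 w) f' = L.form w f' - L.form w a := by
      rw [hg, h3, F.snd.pair]; ring
    have h6 := F.swap.dvd_of_minimal (hw.of_eq g h4)
    rw [h4, h5] at h6
    exact (dvd_sub_right (F.swap.dvd_of_minimal hw)).1 h6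
  intro z
  -- The corrected vector is orthogonal to `e'`, and `(w,f')` is already divisible by `(w,e)`.
  have h7 := key (z - L.form e' z • f') (by simp [F.snd.pair])
  rw [map_sub, map_smul, smul_eq_mul] at h7
  exact (dvd_sub_left ((F.swap.dvd_of_minimal hw).mul_left _)).1 h7

end Eichler

/-! ### Primitive vectors and divisors -/

section Primitive

variable {L : EvenLattice}

/-- After cancelling `gcd(c, β)`, a Bézout relation exhibits `h` as a multiple of the remaining part
of `β`, which must then be a unit. -/
theorem IsPrimitive.dvd_of_smul_eq {h : L} (hp : IsPrimitive h) {c β : ℤ} (hβ : β ≠ 0) {y : L}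
    (hy : c • h = β • y) : β ∣ c := by
  obtain ⟨g, β', c', hg, hcop, rfl, rfl⟩ : ∃ g β' c' : ℤ, g ≠ 0 ∧ IsCoprime β' c' ∧
      β = g * β' ∧ c = g * c' := by
    refine ⟨gcd c β, β / gcd c β, c / gcd c β, gcd_ne_zero_of_right hβ,
      (isCoprime_div_gcd_div_gcd hβ).symm, (Int.mul_ediv_cancel' (gcd_dvd_right _ _)).symm,
      (Int.mul_ediv_cancel' (gcd_dvd_left _ _)).symm⟩
  rw [mul_smul, mul_smul] at hy
  have hy' : c' • h = β' • y := smul_right_injective L hg hy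
  obtain ⟨u, w, huw⟩ := hcop
  have h1 : h = β' • (u • h + w • y) := by
    have : h = (u * β' + w * c') • h := by rw [huw, one_smul]
    rw [add_smul, mul_smul w, hy'] at this
    conv_lhs => rw [this]
    module
  have := hp _ _ h1
  exact mul_dvd_mul_left g this.dvd

theorem divisor_dvd (h y : L) : (divisor h : ℤ) ∣ L.form h y := by
  rw [divisor, Int.natAbs_dvd]
  exact (Submodule.IsPrincipal.mem_iff_generator_dvd _).1 ⟨y, rfl⟩

theorem exists_form_eq_divisor (h : L) : ∃ y, L.form h y = divisor h := by
  obtain ⟨y, hy⟩ := Submodule.IsPrincipal.generator_mem (LinearMap.range (L.form h))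
  rw [divisor, ← hy]
  rcases Int.natAbs_eq (L.form h y) with h1 | h1
  · exact ⟨y, h1⟩
  · refine ⟨-y, ?_⟩
    rw [map_neg]
    lia

theorem divisor_eq {h : L} {β : ℕ} (h1 : ∀ y, (β : ℤ) ∣ L.form h y)
    (h2 : ∃ y, L.form h y = β) : divisor h = β := by
  obtain ⟨y, hy⟩ := h2
  obtain ⟨z, hz⟩ := exists_form_eq_divisor h
  apply Nat.dvd_antisymm
  · have := divisor_dvd h y
    rw [hy] at this
    exact_mod_cast this
  · have := h1 z
    rw [hz] at this
    exact_mod_cast this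

end Primitive

/-! ### Normal forms of primitive vectors of `L_A` -/

section NormalForm

variable {L M : EvenLattice}

/-- The coordinates on `U`. -/
def coordU : U ≃ₗ[ℤ] (Fin 2 → ℤ) := LinearEquiv.refl ℤ (Fin 2 → ℤ)

theorem form_U (x y : U) : U.form x y = coordU x 0 * coordU y 1 + coordU x 1 * coordU y 0 := by
  change Matrix.toBilin' !![0, 1; 1, 0] (coordU x) (coordU y) = _
  simp [Matrix.toBilin'_apply, Fin.sum_univ_two]

/-- The coordinates on `A₂(-1)`. -/
def coordA : A2.rescale (-1) ≃ₗ[ℤ] (Fin 2 → ℤ) := LinearEquiv.refl ℤ (Fin 2 → ℤ)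

theorem form_A2_neg (x y : A2.rescale (-1)) : (A2.rescale (-1)).form x y =
    -(2 * coordA x 0 * coordA y 0 - coordA x 0 * coordA y 1 - coordA x 1 * coordA y 0 +
      2 * coordA x 1 * coordA y 1) := by
  have h : CartanMatrix.A 2 = !![2, -1; -1, 2] := by decide
  change (-1) • Matrix.toBilin' (CartanMatrix.A 2) (coordA x) (coordA y) = _
  simp [h, Matrix.toBilin'_apply, Fin.sum_univ_two]
  ring

/-- The vector `α e + β f` of `U`. -/
def vU (α β : ℤ) : U := coordU.symm ![α, β]

theorem coordU_vU (α β : ℤ) : coordU (vU α β) = ![α, β] := LinearEquiv.apply_symm_apply _ _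

theorem eq_vU (u : U) : u = vU (coordU u 0) (coordU u 1) := by
  apply coordU.injective
  rw [coordU_vU]
  funext i
  fin_cases i <;> rfl

/-- The vector `α a₁ + β a₂` of `A₂(-1)`. -/
def vA (α β : ℤ) : A2.rescale (-1) := coordA.symm ![α, β]

theorem coordA_vA (α β : ℤ) : coordA (vA α β) = ![α, β] := LinearEquiv.apply_symm_apply _ _

theorem ext_A {s t : A2.rescale (-1)} (h0 : coordA s 0 = coordA t 0)
    (h1 : coordA s 1 = coordA t 1) : s = t := by
  apply coordA.injective
  funext i
  fin_cases i
  · exact h0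
  · exact h1

/-- The standard basis vector `e` of `U`. -/
abbrev eU : U := vU 1 0

/-- The standard basis vector `f` of `U`. -/
abbrev fU : U := vU 0 1

theorem isHyperbolicPair_U : IsHyperbolicPair eU fU where
  left := by simp [coordU_vU, form_U]
  right := by simp [coordU_vU, form_U]
  pair := by simp [coordU_vU, form_U]

theorem isHyperbolicFrame_inl (M : EvenLattice) :
    IsHyperbolicFrame (L := U ⊞ U ⊞ M) (inlSum _ _ eU) (inlSum _ _ fU)
      (inrSum _ _ (inlSum _ _ eU)) (inrSum _ _ (inlSum _ _ fU)) where
  fst := ⟨by rw [form_inl_left, fst_inl, isHyperbolicPair_U.left],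
    by rw [form_inl_left, fst_inl, isHyperbolicPair_U.right],
    by rw [form_inl_left, fst_inl, isHyperbolicPair_U.pair]⟩
  snd := ⟨by rw [form_inr_left, snd_inr, form_inl_left, fst_inl, isHyperbolicPair_U.left],
    by rw [form_inr_left, snd_inr, form_inl_left, fst_inl, isHyperbolicPair_U.right],
    by rw [form_inr_left, snd_inr, form_inl_left, fst_inl, isHyperbolicPair_U.pair]⟩
  ee := by rw [form_inl_left, fst_inr, map_zero]
  ef := by rw [form_inl_left, fst_inr, map_zero]
  fe := by rw [form_inl_left, fst_inr, map_zero]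
  ff := by rw [form_inl_left, fst_inr, map_zero]

/-- The component of `v ∈ U ⊕ M` in `M` can be changed by multiples of the coefficient of `f`. -/
theorem exists_translate (v : (U ⊞ M : EvenLattice)) (a : M) :
    ∃ g : (U ⊞ M).O, sndSum U M (g.1 v) =
        sndSum U M v + (U ⊞ M).form v (inlSum U M eU) • a ∧
      (U ⊞ M).form (g.1 v) (inlSum U M eU) = (U ⊞ M).form v (inlSum U M eU) := by
  have hc : (U ⊞ M).form (inlSum U M eU) (inlSum U M eU) = 0 := by
    rw [form_inl_left, fst_inl, isHyperbolicPair_U.left]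
  have hca : (U ⊞ M).form (inlSum U M eU) (inrSum U M a) = 0 := by
    rw [form_inl_left, fst_inr, map_zero]
  obtain ⟨g, k, hk, hg⟩ := exists_transvection hc hca
  refine ⟨g, ?_, ?_⟩
  · rw [hg, transvection_apply]
    simp only [map_add, map_sub, map_smul, snd_inl, snd_inr, smul_zero, sub_zero]
    rw [(U ⊞ M).symm v]
  · rw [hg, transvection_apply]
    simp only [map_add, map_sub, map_smul, LinearMap.add_apply, LinearMap.sub_apply,
      LinearMap.smul_apply, hc, (U ⊞ M).symm (inrSum U M a), hca, smul_zero, sub_zero, add_zero]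

/-- The isometry `(u, w) ↦ (u, -w)` of `L ⊕ M`. -/
def negRight (L M : EvenLattice) : (L ⊞ M).O :=
  ⟨(LinearEquiv.refl ℤ L).prodCongr (LinearEquiv.neg ℤ), fun x y => by
    have h : M.form (-(sndSum L M x)) (-(sndSum L M y)) = M.form (sndSum L M x) (sndSum L M y) := by
      simp
    exact congrArg (L.form (fstSum L M x) (fstSum L M y) + ·) h⟩

/-- The inclusion of `S` into `2U ⊕ 2E₈(-1) ⊕ S`. -/
def ofS (S : EvenLattice) : S →ₗ[ℤ] twoUtwoE8 S :=
  inrSum U _ ∘ₗ inrSum U _ ∘ₗ inrSum (E8.rescale (-1)) _ ∘ₗ inrSum (E8.rescale (-1)) S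

/-- The projection of `2U ⊕ 2E₈(-1) ⊕ S` to `S`. -/
def toS (S : EvenLattice) : twoUtwoE8 S →ₗ[ℤ] S :=
  sndSum (E8.rescale (-1)) S ∘ₗ sndSum (E8.rescale (-1)) _ ∘ₗ sndSum U _ ∘ₗ sndSum U _

theorem form_toS_left {S : EvenLattice} (w : twoUtwoE8 S) (s : S) :
    S.form (toS S w) s = (twoUtwoE8 S).form w (ofS S s) := by
  have h (w : (U ⊞ U ⊞ E8.rescale (-1) ⊞ E8.rescale (-1) ⊞ S : EvenLattice)) :
      S.form (sndSum _ _ (sndSum _ _ (sndSum _ _ (sndSum _ _ w)))) s =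
      (U ⊞ U ⊞ E8.rescale (-1) ⊞ E8.rescale (-1) ⊞ S).form w
        (inrSum _ _ (inrSum _ _ (inrSum _ _ (inrSum _ _ s)))) := by
    rw [form_snd_left, form_snd_left, form_snd_left, form_snd_left]
  exact h w

theorem form_ofS {S : EvenLattice} (s t : S) :
    (twoUtwoE8 S).form (ofS S s) (ofS S t) = S.form s t := (form_toS_left (ofS S s) t).symm

theorem sum_eq_smul_add_inr (hL : L.IsUnimodular) {β : ℤ} (hβ : β ≠ 0) {w : (L ⊞ M : EvenLattice)}
    (hw : ∀ z, β ∣ (L ⊞ M).form w z) :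
    (∃ l, w = inlSum L M (β • l) + inrSum L M (sndSum L M w)) ∧
      ∀ z, β ∣ M.form (sndSum L M w) z := by
  refine ⟨?_, fun z => by rw [form_snd_left]; exact hw _⟩
  obtain ⟨l, hl⟩ := hL β (fstSum L M w) hβ fun z => by rw [form_fst_left]; exact hw _
  exact ⟨l, by rw [← hl, inl_fst_add_inr_snd]⟩

theorem eq_smul_add_ofS {S : EvenLattice} {β : ℤ} (hβ : β ≠ 0) {w : twoUtwoE8 S}
    (hw : ∀ z, β ∣ (twoUtwoE8 S).form w z) :
    (∃ m, w = β • m + ofS S (toS S w)) ∧ ∀ z, β ∣ S.form (toS S w) z := by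
  obtain ⟨⟨l₁, h₁⟩, hw₁⟩ := sum_eq_smul_add_inr isUnimodular_U hβ hw
  obtain ⟨⟨l₂, h₂⟩, hw₂⟩ := sum_eq_smul_add_inr isUnimodular_U hβ hw₁
  obtain ⟨⟨l₃, h₃⟩, hw₃⟩ := sum_eq_smul_add_inr isUnimodular_E8.rescale_neg_one hβ hw₂
  obtain ⟨⟨l₄, h₄⟩, hw₄⟩ := sum_eq_smul_add_inr isUnimodular_E8.rescale_neg_one hβ hw₃
  refine ⟨⟨inlSum _ _ l₁ + inrSum _ _ (inlSum _ _ l₂ + inrSum _ _ (inlSum _ _ l₃ +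
    inrSum _ _ (inlSum _ _ l₄))), ?_⟩, hw₄⟩
  rw [h₄] at h₃
  rw [h₃] at h₂
  rw [h₂] at h₁
  have key : ∀ s : S, inlSum U (U ⊞ E8.rescale (-1) ⊞ E8.rescale (-1) ⊞ S) (β • l₁) +
      inrSum _ _ (inlSum _ _ (β • l₂) + inrSum _ _ (inlSum _ _ (β • l₃) +
        inrSum _ _ (inlSum _ _ (β • l₄) + inrSum _ _ s))) =
      β • (inlSum _ _ l₁ + inrSum _ _ (inlSum _ _ l₂ + inrSum _ _ (inlSum _ _ l₃ +
        inrSum _ _ (inlSum _ _ l₄)))) + inrSum _ _ (inrSum _ _ (inrSum _ _ (inrSum _ _ s))) := by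
    intro s
    simp only [map_add, map_smul, smul_add, add_assoc]
  exact h₁.trans (key _)

/-- The vector `a₁ - a₂` of `A₂(-1)`. -/
abbrev vA2 : A2.rescale (-1) := vA 1 (-1)

/-- The Gram matrix has determinant 3, so `3 A₂^∨ ⊆ A₂`. The witness is `3 G⁻¹` applied to the
quotients `(a, b)`, with `G` the Gram matrix of `A₂(-1)`. -/
theorem eq_of_dvd_A2 {β : ℤ} {s : A2.rescale (-1)} (hs : ∀ z, β ∣ (A2.rescale (-1)).form s z) :
    ∃ t, (3 : ℤ) • s = β • t := by
  obtain ⟨a, ha⟩ := hs (vA 1 0)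
  obtain ⟨b, hb⟩ := hs (vA 0 1)
  rw [form_A2_neg, coordA_vA] at ha hb
  simp at ha hb
  refine ⟨vA (-2 * a - b) (-a - 2 * b), ext_A ?_ ?_⟩ <;> simp [coordA_vA] <;> linarith

/-- These are the three classes of `D(A₂(-1)) ≅ ℤ/3`, generated by `(a₁ - a₂)/3`. The product with
`a₁` gives `s₁ ≡ 2 s₀` modulo 3, so the class of `s₀` modulo 3 determines that of `s`. -/
theorem eq_of_three_dvd_A2 {s : A2.rescale (-1)} (hs : ∀ z, 3 ∣ (A2.rescale (-1)).form s z) :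
    ∃ t, s = (3 : ℤ) • t ∨ s = (3 : ℤ) • t + vA2 ∨ s = (3 : ℤ) • t - vA2 := by
  obtain ⟨a, ha⟩ := hs (vA 1 0)
  rw [form_A2_neg, coordA_vA] at ha
  have h1 : coordA s 1 = 2 * coordA s 0 + 3 * a := by simp at ha; linarith
  obtain ⟨q, hq | hq | hq⟩ : ∃ q, coordA s 0 = 3 * q ∨ coordA s 0 = 3 * q + 1 ∨
      coordA s 0 = 3 * q - 1 := ⟨(coordA s 0 + 1) / 3, by lia⟩
  · refine ⟨vA q (2 * q + a), Or.inl (ext_A ?_ ?_)⟩ <;> simp [coordA_vA, h1, hq]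
    ring
  · refine ⟨vA q (2 * q + a + 1), Or.inr (Or.inl (ext_A ?_ ?_))⟩ <;> simp [coordA_vA, h1, hq]
    ring
  · refine ⟨vA q (2 * q + a - 1), Or.inr (Or.inr (ext_A ?_ ?_))⟩ <;> simp [coordA_vA, h1, hq]
    ring

theorem form_vU (α β : ℤ) (y : U) : U.form (vU α β) y = α * coordU y 1 + β * coordU y 0 := by
  rw [form_U, coordU_vU]; rfl

theorem form_inl_eU (v : (U ⊞ M : EvenLattice)) :
    (U ⊞ M).form v (inlSum U M eU) = coordU (fstSum U M v) 1 := by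
  rw [← form_fst_left, form_U, coordU_vU]
  simp

theorem form_inl_fU (v : (U ⊞ M : EvenLattice)) :
    (U ⊞ M).form v (inlSum U M fU) = coordU (fstSum U M v) 0 := by
  rw [← form_fst_left, form_U, coordU_vU]
  simp

theorem smul_vU (c α β : ℤ) : c • vU α β = vU (c * α) (c * β) := by
  rw [vU, vU, ← map_smul]
  simp

theorem IsPrimitive.map (g : L.O) {h : L} (hp : IsPrimitive h) : IsPrimitive (g.1 h) := by
  intro n x hx
  refine hp n (g.1.symm x) (g.1.injective ?_)
  rw [hx, map_smul, LinearEquiv.apply_symm_apply]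

theorem form_inv (g : L.O) (h x : L) : L.form (g.1 h) x = L.form h (g.1.symm x) := by
  conv_rhs => rw [← g.2]
  rw [LinearEquiv.apply_symm_apply]

theorem divisor_eq_of_orbit (g : L.O) {h e : L} {β : ℕ} (h1 : L.form (g.1 h) e = β)
    (h2 : ∀ z, (β : ℤ) ∣ L.form (g.1 h) z) : divisor h = β := by
  refine divisor_eq (fun y => ?_) ⟨g.1.symm e, by rw [← form_inv, h1]⟩
  have := h2 (g.1 y)
  rwa [g.2] at this

/-- The orthogonal complement of a hyperbolic plane in `L_A`. -/
abbrev MA : EvenLattice := twoUtwoE8 (A2.rescale (-1))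

/-- In a primitive vector of `L_A`, all products can only be divisible by divisors of `3`. -/
theorem dvd_three_of_isPrimitive {v : (U ⊞ MA : EvenLattice)} (hp : IsPrimitive v) {β : ℤ}
    (hβ : β ≠ 0) (hv : ∀ z, β ∣ (U ⊞ MA).form v z) : β ∣ 3 := by
  obtain ⟨⟨l, hl⟩, hw⟩ := sum_eq_smul_add_inr isUnimodular_U hβ hv
  obtain ⟨⟨m, hm⟩, hs⟩ := eq_smul_add_ofS hβ hw
  obtain ⟨t, ht⟩ := eq_of_dvd_A2 hs
  -- The unimodular components are already multiples of `β`; the `A₂(-1)`-component becomes one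
  -- after multiplication by 3. Hence `3 v = β y`.
  refine hp.dvd_of_smul_eq hβ (y := (3 : ℤ) • inlSum _ _ l + inrSum U _ ((3 : ℤ) • m + ofS _ t)) ?_
  rw [hm] at hl
  rw [hl, smul_add, ← map_smul (inrSum U _), smul_add, ← map_smul (ofS _), ht]
  simp only [map_add, map_smul, smul_add, smul_smul]
  rw [mul_comm β 3]

/-- An explicit instance of Eichler's criterion: divisor and square determine the orbit. With the
coefficient of `f` equal to the divisor, a translation reduces the `MA`-component modulo the
divisor, and the square fixes the coefficient of `e`. -/
theorem exists_normalForm {d : ℕ} (hd : 0 < d) {h : (U ⊞ MA : EvenLattice)}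
    (hprim : IsPrimitive h) (hsq : (U ⊞ MA).form h h = 2 * (d : ℤ)) :
    (divisor h = 1 ∧ ∃ ψ : (U ⊞ MA).O, ψ.1 h = inlSum U MA (vU d 1)) ∨
    (divisor h = 3 ∧ ∃ k : ℤ, 1 ≤ k ∧ (d : ℤ) = 9 * k - 3 ∧ ∃ ψ : (U ⊞ MA).O,
      ψ.1 h = inlSum U MA (vU (3 * k) 3) + inrSum U MA (ofS _ vA2)) := by
  have F : IsHyperbolicFrame (L := U ⊞ MA) (inlSum _ _ eU) (inlSum _ _ fU)
    (inrSum _ _ (inlSum _ _ eU)) (inrSum _ _ (inlSum _ _ fU)) := isHyperbolicFrame_inl _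
  obtain ⟨g, hpos, hg⟩ := F.exists_dvd h h (by rw [hsq]; positivity)
  have hd3 := dvd_three_of_isPrimitive (hprim.map g) hpos.ne' hg
  have hβ : (U ⊞ MA).form (g.1 h) (inlSum U MA eU) = 1 ∨
      (U ⊞ MA).form (g.1 h) (inlSum U MA eU) = 3 := by
    have h3 : (U ⊞ MA).form (g.1 h) (inlSum U MA eU) ≤ 3 := Int.le_of_dvd (by norm_num) hd3
    generalize (U ⊞ MA).form (g.1 h) (inlSum U MA eU) = β at *
    interval_cases β
    · exact Or.inl rfl
    · norm_num at hd3
    · exact Or.inr rfl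
  have hsq' : ∀ g' : (U ⊞ MA).O, (U ⊞ MA).form (g'.1 h) (g'.1 h) = 2 * d := fun g' => by
    rw [g'.2, hsq]
  obtain ⟨w, hw⟩ : ∃ w, w = sndSum U MA (g.1 h) := ⟨_, rfl⟩
  rcases hβ with hβ | hβ
  · left
    refine ⟨divisor_eq_of_orbit g (e := inlSum U MA eU) (by exact_mod_cast hβ)
      (fun z => by simp), ?_⟩
    -- The coefficient of `f` is 1, so the whole component in `MA` can be removed.
    obtain ⟨g', h1, h2⟩ := exists_translate (g.1 h) (-w)
    refine ⟨g' * g, ?_⟩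
    change g'.1 (g.1 h) = _
    rw [hβ, ← hw, one_smul, add_neg_cancel] at h1
    rw [hβ, form_inl_eU] at h2
    obtain ⟨α, hα⟩ : ∃ α, α = coordU (fstSum U MA (g'.1 (g.1 h))) 0 := ⟨_, rfl⟩
    have h3 : fstSum U MA (g'.1 (g.1 h)) = vU α 1 := by
      rw [← h2, hα]; exact eq_vU _
    have h4 : (U ⊞ MA).form (g'.1 (g.1 h)) (g'.1 (g.1 h)) = _ := hsq' (g' * g)
    rw [form_sum, h1, h3, map_zero, add_zero, form_vU, coordU_vU] at h4
    have h5 : α = d := by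
      simp at h4
      linarith
    refine sum_ext ?_ ?_
    · rw [h3, h5, fst_inl]
    · rw [h1, snd_inl]
  · right
    rw [hβ] at hg
    refine ⟨divisor_eq_of_orbit g (e := inlSum U MA eU) (by exact_mod_cast hβ)
      (fun z => by exact_mod_cast hg z), ?_⟩
    have hw3 : ∀ z, 3 ∣ MA.form w z := fun z => by
      rw [hw, form_snd_left]; exact hg _
    obtain ⟨⟨m, hm⟩, hs⟩ := eq_smul_add_ofS (by norm_num) hw3
    obtain ⟨t, ht⟩ := eq_of_three_dvd_A2 hs
    -- The coefficient of `f` is 3, so multiples of 3 can be removed; what remains is `0` or `±(a₁ -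
    -- a₂)`.
    obtain ⟨g', h1, h2⟩ := exists_translate (g.1 h) (-(m + ofS _ t))
    rw [hβ, ← hw, hm] at h1
    rw [hβ] at h2
    have hdiv : ∀ z, 3 ∣ (U ⊞ MA).form (g'.1 (g.1 h)) z := fun z => by
      rw [form_inv]; exact hg _
    obtain ⟨k, hk⟩ : (3 : ℤ) ∣ coordU (fstSum U MA (g'.1 (g.1 h))) 0 := by
      rw [← form_inl_fU]; exact hdiv _
    rw [form_inl_eU] at h2
    have h3 : fstSum U MA (g'.1 (g.1 h)) = vU (3 * k) 3 :=
      (eq_vU _).trans (congrArg₂ vU hk h2)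
    obtain ⟨g'', h4, h5⟩ : ∃ g'' : (U ⊞ MA).O, fstSum U MA (g''.1 h) = vU (3 * k) 3 ∧
        sndSum U MA (g''.1 h) = ofS _ vA2 := by
      rcases ht with ht | ht | ht
      -- With zero remainder the vector would be `3 (k e + f)`, against primitivity.
      · exfalso
        have h4 : g'.1 (g.1 h) = (3 : ℤ) • inlSum U MA (vU k 1) := by
          refine sum_ext ?_ ?_
          · rw [h3, map_smul, fst_inl, smul_vU]; rfl
          · rw [h1, ht, map_smul (sndSum U MA), snd_inl, map_smul]
            module
        have := (hprim.map (g' * g)) _ _ h4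
        rw [Int.isUnit_iff] at this
        lia
      · refine ⟨g' * g, h3, h1.trans ?_⟩
        rw [ht, map_add, map_smul]
        module
      -- The remainder `-(a₁ - a₂)` is brought to the other sign by `-1` on `MA`.
      · refine ⟨negRight U MA * (g' * g), h3, ?_⟩
        change -sndSum U MA (g'.1 (g.1 h)) = _
        rw [h1, ht, map_sub, map_smul]
        module
    have h6 : g''.1 h = inlSum U MA (vU (3 * k) 3) + inrSum U MA (ofS _ vA2) := by
      rw [← h4, ← h5]; exact (inl_fst_add_inr_snd _).symm
    have h7 := hsq' g''
    rw [form_sum, h4, h5, form_ofS, form_vU, form_A2_neg, coordU_vU, coordA_vA] at h7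
    have h8 : (d : ℤ) = 9 * k - 3 := by
      simp at h7
      linarith
    exact ⟨k, by lia, h8, g'', h6⟩

end NormalForm

/-! ### Orthogonal complements -/

section Perp

variable {L L' M N V : EvenLattice}

theorem perpVal_injective {h : L} : Function.Injective (perpVal (L := L) (h := h)) :=
  Subtype.val_injective

theorem form_perp {h : L} (x y : L.perp h) :
    (L.perp h).form x y = L.form (perpVal x) (perpVal y) := rfl

theorem form_perpVal {h : L} (x : L.perp h) : L.form h (perpVal x) = 0 :=
  LinearMap.mem_ker.1 (Subtype.prop (p := (· ∈ LinearMap.ker (L.form h))) x)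

/-- The inclusion `L_h → L`. -/
def perpIncl (L : EvenLattice) (h : L) : L.perp h →ₗ[ℤ] L := (LinearMap.ker (L.form h)).subtype

/-- A vector orthogonal to `h`, as a vector of `L_h`. -/
def mkPerp {h : L} (x : L) (hx : L.form h x = 0) : L.perp h :=
  (⟨x, LinearMap.mem_ker.2 hx⟩ : LinearMap.ker (L.form h))

theorem perpVal_mkPerp {h : L} (x : L) (hx : L.form h x = 0) : perpVal (mkPerp x hx) = x := rfl

/-- A linear map to `L` whose values are orthogonal to `h`, as a map to `L_h`. -/
def liftPerp {h : L} (G : M →ₗ[ℤ] L) (hG : ∀ z, L.form h (G z) = 0) : M →ₗ[ℤ] L.perp h :=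
  G.codRestrict (LinearMap.ker (L.form h)) fun z => LinearMap.mem_ker.2 (hG z)

/-- An isometry `h^⊥ ≅ K` obtained from an isometry of `L` with `L'` that maps `h` to `h₀` and
a parametrization of `h₀^⊥` by `K`. -/
def perpIsometry (ψ : L.form.IsometryEquiv L'.form) (h : L) (h₀ : L') (hψ : ψ h = h₀)
    (F : L' →ₗ[ℤ] M) (G : M →ₗ[ℤ] L') (hG : ∀ z, L'.form h₀ (G z) = 0) (hFG : ∀ z, F (G z) = z)
    (hGF : ∀ x, L'.form h₀ x = 0 → G (F x) = x)
    (hform : ∀ z w, L'.form (G z) (G w) = M.form z w) :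
    (L.perp h).form.IsometryEquiv M.form where
  toLinearEquiv := LinearEquiv.ofLinearMap
    (F ∘ₗ ψ.toLinearEquiv.toLinearMap ∘ₗ perpIncl L h)
    (liftPerp (ψ.toLinearEquiv.symm.toLinearMap ∘ₗ G) fun z => by
      rw [← ψ.map_app, hψ]
      exact (congrArg _ (ψ.toLinearEquiv.apply_symm_apply _)).trans (hG z))
    (LinearMap.ext fun z => (congrArg F (ψ.toLinearEquiv.apply_symm_apply _)).trans (hFG z))
    (LinearMap.ext fun x => perpVal_injective <| by
      have h1 : L'.form h₀ (ψ (perpVal x)) = 0 := by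
        rw [← hψ, ψ.map_app, form_perpVal]
      exact (congrArg ψ.toLinearEquiv.symm (hGF _ h1)).trans
        (ψ.toLinearEquiv.symm_apply_apply _))
  map_app' x y := by
    have h1 : ∀ x : L.perp h, L'.form h₀ (ψ (perpVal x)) = 0 := fun x => by
      rw [← hψ, ψ.map_app, form_perpVal]
    change M.form (F (ψ (perpVal x))) (F (ψ (perpVal y))) = _
    rw [← hform, hGF _ (h1 x), hGF _ (h1 y), ψ.map_app]
    rfl

/-- An element of `O(L)` as an isometry. -/
def isometryOfO (g : L.O) : L.form.IsometryEquiv L.form := ⟨g.1, g.2⟩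

/-- The coordinate on `⟨2k⟩`. -/
def coordR (k : ℤ) : rankOne k ≃ₗ[ℤ] ℤ := LinearEquiv.funUnique (Fin 1) ℤ ℤ

theorem form_rankOne {k : ℤ} (x y : rankOne k) :
    (rankOne k).form x y = 2 * k * coordR k x * coordR k y := by
  have key (x y : Fin 1 → ℤ) : Matrix.toBilin' !![2 * k] x y = 2 * k * x 0 * y 0 := by
    simp only [Matrix.toBilin'_apply, Finset.univ_unique, Fin.default_eq_zero, Finset.sum_singleton,
      Matrix.of_apply, Matrix.cons_val_fin_one]
    ring
  exact key x y

/-- The generator of `⟨2k⟩`. -/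
def genR (k : ℤ) : rankOne k := (coordR k).symm 1

theorem coordR_genR (k : ℤ) : coordR k (genR k) = 1 := LinearEquiv.apply_symm_apply _ _

theorem eq_smul_genR {k : ℤ} (x : rankOne k) : x = coordR k x • genR k := by
  apply (coordR k).injective
  rw [map_smul, coordR_genR, smul_eq_mul, mul_one]

theorem ext_U {s t : U} (h0 : coordU s 0 = coordU t 0) (h1 : coordU s 1 = coordU t 1) : s = t := by
  apply coordU.injective
  funext i
  fin_cases i
  · exact h0
  · exact h1

/-- The parametrization of the orthogonal complement of `k e + f` in `U ⊕ M`. -/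
def perpParamU (M : EvenLattice) (k : ℤ) :
    (M ⊞ rankOne (-k) : EvenLattice) →ₗ[ℤ] (U ⊞ M : EvenLattice) :=
  inlSum U M ∘ₗ ((coordR (-k)).toLinearMap.smulRight (vU (-k) 1)) ∘ₗ sndSum M (rankOne (-k)) +
    inrSum U M ∘ₗ fstSum M (rankOne (-k))

theorem perpParamU_apply (k : ℤ) (z : (M ⊞ rankOne (-k) : EvenLattice)) : perpParamU M k z =
    inlSum U M (coordR (-k) (sndSum _ _ z) • vU (-k) 1) + inrSum U M (fstSum _ _ z) := rfl

/-- The retraction of `U ⊕ M` to the orthogonal complement of `k e + f`. -/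
def perpRetractU (M : EvenLattice) (k : ℤ) :
    (U ⊞ M : EvenLattice) →ₗ[ℤ] (M ⊞ rankOne (-k) : EvenLattice) :=
  inlSum M (rankOne (-k)) ∘ₗ sndSum U M + inrSum M (rankOne (-k)) ∘ₗ
    ((LinearMap.proj 1 ∘ₗ coordU.toLinearMap).smulRight (genR (-k))) ∘ₗ fstSum U M

theorem perpRetractU_apply (k : ℤ) (x : (U ⊞ M : EvenLattice)) : perpRetractU M k x =
    inlSum M (rankOne (-k)) (sndSum U M x) +
      inrSum M (rankOne (-k)) (coordU (fstSum U M x) 1 • genR (-k)) := rfl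

/-- The orthogonal complement of a vector that is equivalent to `k e + f ∈ U ⊕ M`. -/
def perpIsometryU (ψ : L.form.IsometryEquiv (U ⊞ M).form) (h : L) (k : ℤ)
    (hψ : ψ h = inlSum U M (vU k 1)) :
    (L.perp h).form.IsometryEquiv (M ⊞ rankOne (-k)).form :=
  -- Inside `U`, the complement of `k e + f` is spanned by `-k e + f`, of square `-2k`; the
  -- coefficient of `f` is the coordinate on it.
  perpIsometry ψ h _ hψ (perpRetractU M k) (perpParamU M k)
    (fun z => by
      rw [form_inl_left, perpParamU_apply, map_add, fst_inl, fst_inr, add_zero, map_smul, form_vU,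
        coordU_vU]
      simp)
    (fun z => by
      rw [perpRetractU_apply, perpParamU_apply]
      refine sum_ext ?_ ?_
      · simp only [map_add, snd_inl, snd_inr, zero_add, fst_inl, fst_inr, add_zero]
      · simp only [map_add, snd_inl, snd_inr, fst_inl, fst_inr, add_zero, map_smul,
          coordU_vU]
        conv_rhs => rw [eq_smul_genR (sndSum M (rankOne (-k)) z)]
        simp)
    (fun x hx => by
      rw [form_inl_left, form_vU] at hx
      rw [perpRetractU_apply, perpParamU_apply]
      refine sum_ext (ext_U ?_ ?_) ?_
      · simp only [map_add, snd_inl, snd_inr, zero_add, fst_inl, fst_inr, map_smul,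
          coordU_vU, coordR_genR]
        simp
        linarith
      · simp only [map_add, snd_inl, snd_inr, zero_add, fst_inl, fst_inr, map_smul,
          coordU_vU, coordR_genR]
        simp
      · simp only [map_add, fst_inl, fst_inr, add_zero, snd_inl, snd_inr, zero_add, map_smul,
          smul_zero])
    (fun z w => by
      rw [perpParamU_apply, perpParamU_apply, form_sum, form_sum]
      simp only [map_add, fst_inl, fst_inr, add_zero, snd_inl, snd_inr, map_smul,
        form_rankOne, LinearMap.smul_apply, form_vU, coordU_vU]
      simp
      ring)

/-- The lattice with Gram matrix `(2k, -1, 1; -1, 2, -1; 1, -1, 2)`. -/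
def latQ (k : ℤ) : EvenLattice :=
  ofGram !![2 * k, -1, 1; -1, 2, -1; 1, -1, 2]
    (by ext i j; fin_cases i <;> fin_cases j <;> rfl)
    (fun i => by fin_cases i; exacts [even_two_mul k, even_two, even_two])

/-- The coordinates on `Q(-1)`. -/
def coordQ (k : ℤ) : (latQ k).rescale (-1) ≃ₗ[ℤ] (Fin 3 → ℤ) := LinearEquiv.refl ℤ (Fin 3 → ℤ)

theorem form_latQ_neg {k : ℤ} (x y : (latQ k).rescale (-1)) :
    ((latQ k).rescale (-1)).form x y =
      coordQ k x 0 * (-2 * k * coordQ k y 0 + coordQ k y 1 - coordQ k y 2) +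
      coordQ k x 1 * (coordQ k y 0 - 2 * coordQ k y 1 + coordQ k y 2) +
      coordQ k x 2 * (-coordQ k y 0 + coordQ k y 1 - 2 * coordQ k y 2) := by
  change (-1) • Matrix.toBilin' !![2 * k, -1, 1; -1, 2, -1; 1, -1, 2] (coordQ k x) (coordQ k y) = _
  simp [Matrix.toBilin'_apply, Fin.sum_univ_three]
  ring

/-- The vector of `Q(-1)` with given coordinates. -/
def vQ (k a b c : ℤ) : (latQ k).rescale (-1) := (coordQ k).symm ![a, b, c]

theorem coordQ_vQ (k a b c : ℤ) : coordQ k (vQ k a b c) = ![a, b, c] :=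
  LinearEquiv.apply_symm_apply _ _

theorem ext_Q {k : ℤ} {s t : (latQ k).rescale (-1)} (h0 : coordQ k s 0 = coordQ k t 0)
    (h1 : coordQ k s 1 = coordQ k t 1) (h2 : coordQ k s 2 = coordQ k t 2) : s = t := by
  apply (coordQ k).injective
  funext i
  fin_cases i
  · exact h0
  · exact h1
  · exact h2

/-- The linear map `(x, y) ↦ (x₁, y₀, y₁)` from `U ⊕ A₂(-1)` to `Q(-1)`. -/
def retractQ (k : ℤ) : (U × A2.rescale (-1)) →ₗ[ℤ] (latQ k).rescale (-1) where
  toFun x := vQ k (coordU x.1 1) (coordA x.2 0) (coordA x.2 1)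
  map_add' x y := by
    refine ext_Q ?_ ?_ ?_ <;> simp [coordQ_vQ]
  map_smul' c x := by
    refine ext_Q ?_ ?_ ?_ <;> simp [coordQ_vQ]

/-- The linear map `(a, b, c) ↦ (b - c - k a) e + a f` from `Q(-1)` to `U`. -/
def paramQU (k : ℤ) : (latQ k).rescale (-1) →ₗ[ℤ] U where
  toFun x := vU (coordQ k x 1 - coordQ k x 2 - k * coordQ k x 0) (coordQ k x 0)
  map_add' x y := by
    refine ext_U ?_ ?_ <;> simp [coordU_vU]
    ring
  map_smul' c x := by
    refine ext_U ?_ ?_ <;> simp [coordU_vU]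
    ring

/-- The linear map `(a, b, c) ↦ b a₁ + c a₂` from `Q(-1)` to `A₂(-1)`. -/
def paramQA (k : ℤ) : (latQ k).rescale (-1) →ₗ[ℤ] A2.rescale (-1) where
  toFun x := vA (coordQ k x 1) (coordQ k x 2)
  map_add' x y := by
    refine ext_A ?_ ?_ <;> simp [coordA_vA]
  map_smul' c x := by
    refine ext_A ?_ ?_ <;> simp [coordA_vA]

/-- The parametrization of the orthogonal complement of `3 k e + 3 f + a₁ - a₂` in
`U ⊕ V ⊕ A₂(-1)`. -/
def perpParamQ (V : EvenLattice) (k : ℤ) :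
    (V ⊞ (latQ k).rescale (-1) : EvenLattice) →ₗ[ℤ] (U ⊞ V ⊞ A2.rescale (-1) : EvenLattice) :=
  inlSum U (V ⊞ A2.rescale (-1)) ∘ₗ paramQU k ∘ₗ sndSum V _ +
    inrSum U (V ⊞ A2.rescale (-1)) ∘ₗ (inlSum V (A2.rescale (-1)) ∘ₗ fstSum V _ +
      inrSum V (A2.rescale (-1)) ∘ₗ paramQA k ∘ₗ sndSum V _)

theorem perpParamQ_apply (k : ℤ) (z : (V ⊞ (latQ k).rescale (-1) : EvenLattice)) :
    perpParamQ V k z = inlSum U (V ⊞ A2.rescale (-1)) (paramQU k (sndSum _ _ z)) +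
      inrSum U (V ⊞ A2.rescale (-1)) (inlSum V (A2.rescale (-1)) (fstSum _ _ z) +
        inrSum V (A2.rescale (-1)) (paramQA k (sndSum _ _ z))) := rfl

/-- The retraction of `U ⊕ V ⊕ A₂(-1)` to the orthogonal complement of `3 k e + 3 f + a₁ - a₂`. -/
def perpRetractQ (V : EvenLattice) (k : ℤ) :
    (U ⊞ V ⊞ A2.rescale (-1) : EvenLattice) →ₗ[ℤ] (V ⊞ (latQ k).rescale (-1) : EvenLattice) :=
  inlSum V _ ∘ₗ fstSum V (A2.rescale (-1)) ∘ₗ sndSum U (V ⊞ A2.rescale (-1)) + inrSum V _ ∘ₗ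
    retractQ k ∘ₗ (fstSum U (V ⊞ A2.rescale (-1))).prod
      (sndSum V (A2.rescale (-1)) ∘ₗ sndSum U (V ⊞ A2.rescale (-1)))

theorem perpRetractQ_apply (k : ℤ) (x : (U ⊞ V ⊞ A2.rescale (-1) : EvenLattice)) :
    perpRetractQ V k x = inlSum V _ (fstSum V (A2.rescale (-1)) (sndSum _ _ x)) +
      inrSum V _ (vQ k (coordU (fstSum _ _ x) 1) (coordA (sndSum _ _ (sndSum _ _ x)) 0)
        (coordA (sndSum _ _ (sndSum _ _ x)) 1)) := rfl

theorem coordU_paramQU (k : ℤ) (q : (latQ k).rescale (-1)) : coordU (paramQU k q) =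
    ![coordQ k q 1 - coordQ k q 2 - k * coordQ k q 0, coordQ k q 0] := coordU_vU _ _

theorem coordA_paramQA (k : ℤ) (q : (latQ k).rescale (-1)) : coordA (paramQA k q) =
    ![coordQ k q 1, coordQ k q 2] := coordA_vA _ _

theorem form_inl_add_inr_left (u : L) (m : M) (x : (L ⊞ M : EvenLattice)) :
    (L ⊞ M).form (inlSum L M u + inrSum L M m) x =
      L.form u (fstSum L M x) + M.form m (sndSum L M x) := by
  rw [map_add, LinearMap.add_apply, form_inl_left, form_inr_left]

/-- The orthogonal complement of a vector that is equivalent to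
`3 k e + 3 f + a₁ - a₂ ∈ U ⊕ V ⊕ A₂(-1)`. -/
def perpIsometryQ (ψ : L.form.IsometryEquiv (U ⊞ V ⊞ A2.rescale (-1)).form) (h : L) (k : ℤ)
    (hψ : ψ h = inlSum U (V ⊞ A2.rescale (-1)) (vU (3 * k) 3) +
      inrSum U (V ⊞ A2.rescale (-1)) (inrSum V (A2.rescale (-1)) vA2)) :
    (L.perp h).form.IsometryEquiv (V ⊞ (latQ k).rescale (-1)).form :=
  -- For `α e + a f + b a₁ + c a₂`, orthogonality reads `3α + 3k a - 3b + 3c = 0`. It determines `α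
  -- = b - c - k a` and leaves `(a, b, c)` free; the form in these coordinates is that of `Q(-1)`.
  perpIsometry ψ h _ hψ (perpRetractQ V k) (perpParamQ V k)
    (fun z => by
      rw [form_inl_add_inr_left, form_inr_left, perpParamQ_apply]
      simp only [map_add, fst_inl, fst_inr, snd_inl, snd_inr, add_zero, zero_add, form_vU,
        coordU_paramQU, form_A2_neg, coordA_vA, coordA_paramQA]
      simp
      ring)
    (fun z => by
      rw [perpRetractQ_apply, perpParamQ_apply]
      simp only [map_add, fst_inl, fst_inr, snd_inl, snd_inr, add_zero, zero_add,
        coordU_paramQU, coordA_paramQA]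
      conv_rhs => rw [← inl_fst_add_inr_snd z]
      congr 2
      refine ext_Q ?_ ?_ ?_ <;> rw [coordQ_vQ] <;> rfl)
    (fun x hx => by
      rw [form_inl_add_inr_left, form_inr_left, form_vU, form_A2_neg, coordA_vA] at hx
      simp at hx
      rw [perpRetractQ_apply, perpParamQ_apply]
      refine sum_ext (ext_U ?_ ?_) (sum_ext ?_ (ext_A ?_ ?_))
      all_goals simp only [map_add, fst_inl, fst_inr, snd_inl, snd_inr, add_zero, zero_add,
        coordU_paramQU, coordA_paramQA, coordQ_vQ]
      all_goals simp
      linarith)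
    (fun z w => by
      rw [perpParamQ_apply, perpParamQ_apply, form_sum, form_sum, form_sum]
      simp only [map_add, fst_inl, fst_inr, add_zero, snd_inl, snd_inr, zero_add, form_U,
        form_A2_neg, coordU_paramQU, coordA_paramQA, form_latQ_neg]
      simp
      ring)

/-- The lattice `2U ⊕ 2E₈(-1)`. -/
def latV : EvenLattice := U ⊞ U ⊞ E8.rescale (-1) ⊞ E8.rescale (-1)

/-- `2U ⊕ 2E₈(-1) ⊕ S ≅ (2U ⊕ 2E₈(-1)) ⊕ S`. -/
def splitS (S : EvenLattice) : (twoUtwoE8 S).form.IsometryEquiv (latV ⊞ S).form where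
  toFun w := (((w.1, w.2.1, w.2.2.1, w.2.2.2.1), w.2.2.2.2) :
    (U × U × E8.rescale (-1) × E8.rescale (-1)) × S)
  invFun w := ((w.1.1, w.1.2.1, w.1.2.2.1, w.1.2.2.2, w.2) :
    U × U × E8.rescale (-1) × E8.rescale (-1) × S)
  map_add' _ _ := rfl
  map_smul' _ _ := rfl
  left_inv _ := rfl
  right_inv _ := rfl
  map_app' x y := by
    change (U.form x.1 y.1 + (U.form x.2.1 y.2.1 + ((E8.rescale (-1)).form x.2.2.1 y.2.2.1 +
      (E8.rescale (-1)).form x.2.2.2.1 y.2.2.2.1))) + S.form x.2.2.2.2 y.2.2.2.2 =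
      U.form x.1 y.1 + (U.form x.2.1 y.2.1 + ((E8.rescale (-1)).form x.2.2.1 y.2.2.1 +
      ((E8.rescale (-1)).form x.2.2.2.1 y.2.2.2.1 + S.form x.2.2.2.2 y.2.2.2.2)))
    ring

theorem splitS_ofS {S : EvenLattice} (s : S) : splitS S (ofS S s) = inrSum latV S s := rfl

/-- The sum of an isometry with the identity. -/
def sumIsometry (L : EvenLattice) (φ : M.form.IsometryEquiv N.form) :
    (L ⊞ M).form.IsometryEquiv (L ⊞ N).form where
  toLinearEquiv := (LinearEquiv.refl ℤ L).prodCongr φ.toLinearEquiv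
  map_app' x y := congrArg (L.form (fstSum L M x) (fstSum L M y) + ·)
    (φ.map_app (sndSum L M y) (sndSum L M x))

theorem fst_inl_add_inr (a : L) (b : M) : fstSum L M (inlSum L M a + inrSum L M b) = a := by
  rw [map_add, fst_inl, fst_inr, add_zero]

theorem snd_inl_add_inr (a : L) (b : M) : sndSum L M (inlSum L M a + inrSum L M b) = b := by
  rw [map_add, snd_inl, snd_inr, zero_add]

theorem sumIsometry_apply (φ : M.form.IsometryEquiv N.form) (x : (L ⊞ M : EvenLattice)) :
    sumIsometry L φ x = inlSum L N (fstSum L M x) + inrSum L N (φ (sndSum L M x)) :=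
  (inl_fst_add_inr_snd _).symm

end Perp

/-! ### Invariants of `Q(-1)` -/

section Invariants

variable {L : EvenLattice}

/-- A change of basis multiplies the determinant by the square of a unit of `ℤ`, which is 1. -/
theorem det_eq_det_toMatrix {n : ℕ} (b : Module.Basis (Fin n) ℤ L) :
    L.det = (LinearMap.BilinForm.toMatrix b L.form).det := by
  have hn : Module.finrank ℤ L = n := by simpa using Module.finrank_eq_card_basis b
  obtain ⟨c, hc⟩ : ∃ c, c = b.reindex (finCongr hn.symm) := ⟨_, rfl⟩
  have h1 : LinearMap.BilinForm.toMatrix c L.form =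
      (LinearMap.BilinForm.toMatrix b L.form).submatrix (finCongr hn) (finCongr hn) := by
    ext i j
    rw [hc]
    simp [LinearMap.BilinForm.toMatrix_apply]
  have h2 := LinearMap.BilinForm.toMatrix_mul_basis_toMatrix (Module.finBasis ℤ L) c L.form
  have h3 : ((Module.finBasis ℤ L).toMatrix c).det * ((Module.finBasis ℤ L).toMatrix c).det = 1 := by
    apply Int.isUnit_mul_self
    refine IsUnit.of_mul_eq_one ((c.toMatrix (Module.finBasis ℤ L)).det) ?_
    rw [← Matrix.det_mul, Module.Basis.toMatrix_mul_toMatrix_flip, Matrix.det_one]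
  rw [← Matrix.det_submatrix_equiv_self (finCongr hn), ← h1, ← h2, Matrix.det_mul, Matrix.det_mul,
    Matrix.det_transpose, mul_comm, ← mul_assoc, h3, one_mul, det]

theorem finrank_latQ (k : ℤ) : Module.finrank ℤ ((latQ k).rescale (-1)) = 3 := by
  rw [(coordQ k).finrank_eq]
  simp

theorem isNegDef_latQ {k : ℤ} (hk : 1 ≤ k) : ((latQ k).rescale (-1)).IsNegDef := by
  intro x hx
  rw [form_latQ_neg]
  by_contra! h
  apply hx
  obtain ⟨a, ha⟩ : ∃ a, a = coordQ k x 0 := ⟨_, rfl⟩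
  obtain ⟨b, hb⟩ : ∃ b, b = coordQ k x 1 := ⟨_, rfl⟩
  obtain ⟨c, hc⟩ : ∃ c, c = coordQ k x 2 := ⟨_, rfl⟩
  rw [← ha, ← hb, ← hc] at h
  -- The form of `Q` is `2(k - 1)a² + (a - b + c)² + a² + b² + c²`.
  have h1 : 0 ≤ (k - 1) * a ^ 2 := mul_nonneg (by linarith) (sq_nonneg a)
  have h2 := sq_nonneg (a - b + c)
  have h3 : a ^ 2 + b ^ 2 + c ^ 2 ≤ 0 := by nlinarith
  have ha0 : a = 0 := by
    apply pow_eq_zero_iff (two_ne_zero) |>.1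
    linarith [sq_nonneg a, sq_nonneg b, sq_nonneg c]
  have hb0 : b = 0 := by
    apply pow_eq_zero_iff (two_ne_zero) |>.1
    linarith [sq_nonneg a, sq_nonneg b, sq_nonneg c]
  have hc0 : c = 0 := by
    apply pow_eq_zero_iff (two_ne_zero) |>.1
    linarith [sq_nonneg a, sq_nonneg b, sq_nonneg c]
  refine ext_Q ?_ ?_ ?_ <;> simp [← ha, ← hb, ← hc, ha0, hb0, hc0]

theorem det_latQ (k : ℤ) : ((latQ k).rescale (-1)).det = -(6 * k - 2) := by
  rw [det_eq_det_toMatrix (Module.Basis.ofEquivFun (coordQ k)), Matrix.det_fin_three]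
  simp [LinearMap.BilinForm.toMatrix_apply, form_latQ_neg]
  ring

theorem isAddCyclic_of_generator {A : Type*} [AddGroup A] (a : A) (hgen : ∀ x, ∃ j : ℤ, x = j • a) :
    IsAddCyclic A :=
  ⟨⟨a, fun x => by obtain ⟨j, hj⟩ := hgen x; exact ⟨j, hj.symm⟩⟩⟩

theorem card_of_generator {A : Type*} [AddGroup A] (a : A) (hgen : ∀ x, ∃ j : ℤ, x = j • a) {N : ℕ}
    (hN : ∀ j : ℤ, j • a = 0 ↔ (N : ℤ) ∣ j) : Nat.card A = N := by
  rw [← addOrderOf_eq_card_of_forall_mem_zmultiples (g := a)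
    fun x => by obtain ⟨j, hj⟩ := hgen x; exact ⟨j, hj.symm⟩]
  apply Nat.dvd_antisymm
  · have := addOrderOf_dvd_iff_zsmul_eq_zero.2 ((hN N).2 dvd_rfl)
    exact_mod_cast this
  · have := (hN (addOrderOf a)).1 (addOrderOf_dvd_iff_zsmul_eq_zero.1 dvd_rfl)
    exact_mod_cast this

theorem zsmul_frac_eq {β γ j m : ℤ} (hβ : β ≠ 0) (hγ : γ ≠ 0) (h : γ * m = β * j) (v : L) :
    j • L.frac γ v = L.frac β (m • v) := by
  rw [← frac_smul, ← frac_mul_smul hβ γ, ← frac_mul_smul hγ β, smul_smul, smul_smul, h,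
    mul_comm γ β]

/-- The vector `(-3, -1, 1)` has products `6k - 2, 0, 0` with the basis, so its quotient by `6k - 2`
is the first vector of the dual basis. Its last coordinate 1 makes the order exactly `6k - 2`. -/
theorem exists_generator_latQ (k : ℤ) : ∃ a : ((latQ k).rescale (-1)).D,
    (∀ x, ∃ j : ℤ, x = j • a) ∧ ∀ j : ℤ, j • a = 0 ↔ 6 * k - 2 ∣ j := by
  have hN : 6 * k - 2 ≠ 0 := by lia
  have hv : ∀ l, 6 * k - 2 ∣ ((latQ k).rescale (-1)).form (vQ k (-3) (-1) 1) l := fun l => by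
    rw [EvenLattice.symm, form_latQ_neg, coordQ_vQ]
    refine ⟨coordQ k l 0, ?_⟩
    simp
    ring
  refine ⟨toD _ ⟨frac _ (6 * k - 2) (vQ k (-3) (-1) 1), (frac_mem_dual hN _).2 hv⟩, ?_, ?_⟩
  · intro x
    obtain ⟨β, m, hβ, hm, rfl⟩ := exists_eq_toD x
    obtain ⟨z₀, h₀⟩ := hm (vQ k 1 0 0)
    obtain ⟨z₁, h₁⟩ := hm (vQ k 0 1 0)
    obtain ⟨z₂, h₂⟩ := hm (vQ k 0 0 1)
    rw [form_latQ_neg, coordQ_vQ] at h₀ h₁ h₂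
    simp at h₀ h₁ h₂
    -- The products with the last two basis vectors show that `m ≡ m₂ · (-3, -1, 1)` modulo `β`,
    -- where `m₂` is the last coordinate; the product with the first then writes `m₂/β` as `j/(6k -
    -- 2)`.
    have hs : coordQ k m 1 + coordQ k m 2 = β * (-(z₁ + z₂)) := by linarith
    have ht : coordQ k m 0 + 3 * coordQ k m 2 = β * (z₁ - 2 * (z₁ + z₂)) := by linarith
    have hj : (6 * k - 2) * coordQ k m 2 =
        β * (z₀ + 2 * k * (z₁ - 2 * (z₁ + z₂)) + (z₁ + z₂)) := by
      linear_combination h₀ + 2 * k * ht - hs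
    refine ⟨z₀ + 2 * k * (z₁ - 2 * (z₁ + z₂)) + (z₁ + z₂), ?_⟩
    rw [← map_zsmul, toD_eq_iff]
    refine ⟨vQ k (z₁ - 2 * (z₁ + z₂)) (-(z₁ + z₂)) 0, ?_⟩
    rw [AddSubgroupClass.coe_zsmul, zsmul_frac_eq hβ hN hj, ← frac_sub, eq_comm,
      frac_eq_toRat_iff hβ]
    refine ext_Q ?_ ?_ ?_ <;> simp [coordQ_vQ] <;> linarith
  · intro j
    rw [← map_zsmul, toD_eq_zero]
    constructor
    · rintro ⟨l, hl⟩
      rw [AddSubgroupClass.coe_zsmul, ← frac_smul, eq_comm, frac_eq_toRat_iff hN] at hl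
      refine ⟨coordQ k l 2, ?_⟩
      have := congrArg (fun v => coordQ k v 2) hl
      simpa [coordQ_vQ] using this
    · rintro ⟨c, rfl⟩
      refine ⟨c • vQ k (-3) (-1) 1, ?_⟩
      rw [AddSubgroupClass.coe_zsmul, ← frac_smul, mul_smul, frac_self_smul hN]

theorem exists_generator_rankOne {k : ℤ} (hk : k ≠ 0) (h) :
    ∀ x : (rankOne k).D, ∃ j : ℤ,
      x = j • toD _ ⟨(rankOne k).frac (2 * k) (genR k), h⟩ := by
  have hN : 2 * k ≠ 0 := mul_ne_zero two_ne_zero hk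
  intro x
  obtain ⟨β, m, hβ, hm, rfl⟩ := exists_eq_toD x
  obtain ⟨j, hj⟩ := hm (genR k)
  rw [form_rankOne, coordR_genR, mul_one] at hj
  refine ⟨j, ?_⟩
  rw [← map_zsmul, toD_eq_iff]
  refine ⟨0, ?_⟩
  rw [AddSubgroupClass.coe_zsmul, zsmul_frac_eq hβ hN hj, ← eq_smul_genR, sub_self, map_zero]

theorem genR_mem_dual {k : ℤ} (hk : k ≠ 0) : (rankOne k).frac (2 * k) (genR k) ∈ (rankOne k).dual := by
  rw [frac_mem_dual (mul_ne_zero two_ne_zero hk)]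
  intro l
  rw [form_rankOne, coordR_genR]
  exact ⟨coordR k l, by ring⟩

theorem isAddCyclic_rankOne {k : ℤ} (hk : k ≠ 0) : IsAddCyclic (rankOne k).D :=
  isAddCyclic_of_generator _ (exists_generator_rankOne hk (genR_mem_dual hk))

/-- If the products of the dual vector with the basis are `a, b`, its square is `-(2/3)(a² + ab +
b²)`. This is an even integer only if 3 divides `a² + ab + b² ≡ (a - b)²`, and `3 ∣ a - b` puts the
vector in the lattice. -/
theorem eq_zero_of_q_A2 (x : (A2.rescale (-1)).D) (hx : (A2.rescale (-1)).q x = 0) : x = 0 := by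
  obtain ⟨β, m, hβ, hm, rfl⟩ := exists_eq_toD x
  obtain ⟨a, ha⟩ := hm (vA 1 0)
  obtain ⟨b, hb⟩ := hm (vA 0 1)
  rw [form_A2_neg, coordA_vA] at ha hb
  simp at ha hb
  rw [q_toD_eq_zero] at hx
  obtain ⟨k, hk⟩ := hx
  have hβ' : (β : ℚ) ≠ 0 := by exact_mod_cast hβ
  rw [formQ_frac_frac, div_eq_iff (mul_ne_zero hβ' hβ'), form_A2_neg] at hk
  have h0 : 3 * coordA m 0 = β * (-2 * a - b) := by linarith
  have h1 : 3 * coordA m 1 = β * (-a - 2 * b) := by linarith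
  have hk' : -(2 * coordA m 0 * coordA m 0 - coordA m 0 * coordA m 1 - coordA m 1 * coordA m 0 +
      2 * coordA m 1 * coordA m 1) = 2 * k * (β * β) := by exact_mod_cast hk
  have h2 : β ^ 2 * (a * a + a * b + b * b + 3 * k) = 0 := by
    have h3 : 6 * (β ^ 2 * (a * a + a * b + b * b + 3 * k)) = 0 := by
      linear_combination (-9) * hk' -
        (2 * (3 * coordA m 0 + β * (-2 * a - b)) - 2 * (3 * coordA m 1)) * h0 -
        (2 * (3 * coordA m 1 + β * (-a - 2 * b)) - 2 * (β * (-2 * a - b))) * h1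
    linarith
  have h3 : a * a + a * b + b * b + 3 * k = 0 :=
    (mul_eq_zero.1 h2).resolve_left (pow_ne_zero 2 hβ)
  obtain ⟨c, hc⟩ : (3 : ℤ) ∣ a - b := by
    have : (3 : ℤ) ∣ (a - b) ^ 2 := ⟨-(k + a * b), by linarith⟩
    exact Int.prime_three.dvd_of_dvd_pow this
  rw [toD_frac_eq_zero hβ]
  refine ⟨vA (-a + c) (-b - c), ext_A ?_ ?_⟩ <;> simp [coordA_vA] <;>
  · apply mul_left_cancel₀ (by norm_num : (3 : ℤ) ≠ 0)
    first
    | rw [h0]; linear_combination β * hc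
    | rw [h1]; linear_combination (-β) * hc

end Invariants

/-! ### Signatures -/

section Signature

variable {L M : EvenLattice}

/-- `L` contains an orthogonal frame with `p` vectors of positive and `q` vectors of negative
square, and has rank `p + q`. -/
def HasOrthFrame (L : EvenLattice) (p q : ℕ) : Prop :=
  Module.finrank ℤ L = p + q ∧ ∃ v : Fin p ⊕ Fin q → L,
    (∀ i j, i ≠ j → L.form (v i) (v j) = 0) ∧ (∀ i, 0 < L.form (v (Sum.inl i)) (v (Sum.inl i))) ∧
      ∀ j, L.form (v (Sum.inr j)) (v (Sum.inr j)) < 0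

/-- By the rank condition the frame becomes an orthogonal basis of `L ⊗ ℝ`, and Sylvester's law
counts the signs. The frame need not generate `L` over `ℤ`. -/
theorem HasOrthFrame.hasSignature {p q : ℕ} (h : L.HasOrthFrame p q) : L.HasSignature p q := by
  obtain ⟨hr, v, hv, hp, hq⟩ := h
  have hform : ∀ i j, L.form.baseChange ℝ ((1 : ℝ) ⊗ₜ[ℤ] v i) ((1 : ℝ) ⊗ₜ[ℤ] v j) =
      (L.form (v i) (v j) : ℝ) := fun i j => by
    simp [LinearMap.BilinForm.baseChange_tmul]
  have hne : ∀ i, L.form.baseChange ℝ ((1 : ℝ) ⊗ₜ[ℤ] v i) ((1 : ℝ) ⊗ₜ[ℤ] v i) ≠ 0 := fun i => by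
    rw [hform]
    rcases i with i | i
    · exact_mod_cast (hp i).ne'
    · exact_mod_cast (hq i).ne
  have hli : LinearIndependent ℝ fun i => (1 : ℝ) ⊗ₜ[ℤ] v i := by
    refine LinearMap.BilinForm.linearIndependent_of_iIsOrtho (B := L.form.baseChange ℝ) ?_ hne
    intro i j hij
    change L.form.baseChange ℝ _ _ = 0
    rw [hform, hv i j hij, Int.cast_zero]
  have hcard : Fintype.card (Fin p ⊕ Fin q) = Module.finrank ℝ (ℝ ⊗[ℤ] L) := by
    rw [Module.finrank_baseChange, hr]
    simp
  obtain ⟨b, hb⟩ : ∃ b : Module.Basis (Fin p ⊕ Fin q) ℝ (ℝ ⊗[ℤ] L),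
      ⇑b = fun i => (1 : ℝ) ⊗ₜ[ℤ] v i :=
    ⟨.mk hli (hli.span_eq_top_of_card_eq_finrank' hcard).ge, by simp⟩
  have hsymm : LinearMap.IsSymm (L.form.baseChange ℝ) :=
    LinearMap.BilinForm.IsSymm.baseChange ℝ ⟨fun x y => L.symm x y⟩
  obtain ⟨Q, hQ⟩ : ∃ Q, Q = LinearMap.BilinMap.toQuadraticMap (L.form.baseChange ℝ) := ⟨_, rfl⟩
  have hassoc : QuadraticMap.associated (R := ℝ) Q = L.form.baseChange ℝ := by
    rw [hQ]
    exact QuadraticMap.associated_left_inverse ℝ hsymm.eq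
  have hortho : (QuadraticMap.associated (R := ℝ) Q).IsOrthoᵢ b := by
    rw [hassoc, hb]
    intro i j hij
    change L.form.baseChange ℝ _ _ = 0
    rw [hform, hv i j hij, Int.cast_zero]
  have hequiv : QuadraticMap.Equivalent Q
      (QuadraticMap.weightedSumSquares ℝ fun i => (L.form (v i) (v i) : ℝ)) := by
    have h1 : ∀ i, Q (b i) = (L.form (v i) (v i) : ℝ) := fun i => by
      rw [hQ, hb, LinearMap.BilinMap.toQuadraticMap_apply, hform]
    have h2 := QuadraticMap.basisRepr_eq_of_iIsOrtho Q b hortho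
    simp only [h1] at h2
    exact ⟨h2 ▸ Q.isometryEquivBasisRepr b⟩
  refine ⟨hr, ?_, ?_⟩
  · rw [← hQ, QuadraticForm.sigPos_of_equiv_weightedSumSquares hequiv]
    have : {i | 0 < (L.form (v i) (v i) : ℝ)} = Set.range (Sum.inl : Fin p → Fin p ⊕ Fin q) := by
      ext i
      rcases i with i | i
      · simpa using hp i
      · simpa using (hq i).le
    rw [this, Set.ncard_range_of_injective Sum.inl_injective]
    simp
  · rw [← hQ, QuadraticForm.sigNeg_of_equiv_weightedSumSquares hequiv]
    have : {i | (L.form (v i) (v i) : ℝ) < 0} = Set.range (Sum.inr : Fin q → Fin p ⊕ Fin q) := by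
      ext i
      rcases i with i | i
      · simpa using (hp i).le
      · simpa using hq i
    rw [this, Set.ncard_range_of_injective Sum.inr_injective]
    simp

theorem finrank_sum (L M : EvenLattice) :
    Module.finrank ℤ (L ⊞ M : EvenLattice) = Module.finrank ℤ L + Module.finrank ℤ M :=
  Module.finrank_prod

theorem HasOrthFrame.sum {p q p' q' : ℕ} (hL : L.HasOrthFrame p q) (hM : M.HasOrthFrame p' q') :
    (L ⊞ M).HasOrthFrame (p + p') (q + q') := by
  obtain ⟨hr, v, hv, hp, hq⟩ := hL
  obtain ⟨hr', v', hv', hp', hq'⟩ := hM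
  refine ⟨by rw [finrank_sum]; lia, ?_⟩
  let e : Fin (p + p') ⊕ Fin (q + q') ≃ (Fin p ⊕ Fin q) ⊕ (Fin p' ⊕ Fin q') :=
    (Equiv.sumCongr finSumFinEquiv.symm finSumFinEquiv.symm).trans (Equiv.sumSumSumComm _ _ _ _)
  let w : (Fin p ⊕ Fin q) ⊕ (Fin p' ⊕ Fin q') → (L ⊞ M : EvenLattice) :=
    Sum.elim (fun i => inlSum L M (v i)) (fun i => inrSum L M (v' i))
  have hw : ∀ i j, i ≠ j → (L ⊞ M).form (w i) (w j) = 0 := by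
    rintro (i | i) (j | j) hij
    · simp only [w, Sum.elim_inl]
      rw [form_inl_left, fst_inl, hv i j (by simpa using hij)]
    · simp only [w, Sum.elim_inl, Sum.elim_inr]
      rw [form_inl_left, fst_inr, map_zero]
    · simp only [w, Sum.elim_inl, Sum.elim_inr]
      rw [form_inr_left, snd_inl, map_zero]
    · simp only [w, Sum.elim_inr]
      rw [form_inr_left, snd_inr, hv' i j (by simpa using hij)]
  refine ⟨w ∘ e, fun i j hij => hw _ _ (e.injective.ne hij), fun i => ?_, fun j => ?_⟩
  · obtain ⟨k, rfl⟩ := finSumFinEquiv.surjective i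
    rcases k with k | k
    · have : e (Sum.inl (finSumFinEquiv (Sum.inl k))) = Sum.inl (Sum.inl k) := by simp [e]
      simp only [Function.comp_apply, this, w, Sum.elim_inl]
      rw [form_inl_left, fst_inl]
      exact hp k
    · have : e (Sum.inl (finSumFinEquiv (Sum.inr k))) = Sum.inr (Sum.inl k) := by simp [e]
      simp only [Function.comp_apply, this, w, Sum.elim_inr]
      rw [form_inr_left, snd_inr]
      exact hp' k
  · obtain ⟨k, rfl⟩ := finSumFinEquiv.surjective j
    rcases k with k | k
    · have : e (Sum.inr (finSumFinEquiv (Sum.inl k))) = Sum.inl (Sum.inr k) := by simp [e]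
      simp only [Function.comp_apply, this, w, Sum.elim_inl]
      rw [form_inl_left, fst_inl]
      exact hq k
    · have : e (Sum.inr (finSumFinEquiv (Sum.inr k))) = Sum.inr (Sum.inr k) := by simp [e]
      simp only [Function.comp_apply, this, w, Sum.elim_inr]
      rw [form_inr_left, snd_inr]
      exact hq' k

theorem HasOrthFrame.of_isometry {p q : ℕ} (hM : M.HasOrthFrame p q)
    (φ : L.form.IsometryEquiv M.form) : L.HasOrthFrame p q := by
  obtain ⟨hr, v, hv, hp, hq⟩ := hM
  refine ⟨by rw [φ.toLinearEquiv.finrank_eq, hr], fun i => φ.symm (v i), ?_, ?_, ?_⟩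
  · intro i j hij
    rw [φ.symm.map_app, hv i j hij]
  · intro i
    rw [φ.symm.map_app]
    exact hp i
  · intro i
    rw [φ.symm.map_app]
    exact hq i

/-- An orthogonal frame of vectors of negative squares. -/
theorem HasOrthFrame.of_neg {q : ℕ} (hr : Module.finrank ℤ L = q) (v : Fin q → L)
    (hv : ∀ i j, i ≠ j → L.form (v i) (v j) = 0) (hneg : ∀ i, L.form (v i) (v i) < 0) :
    L.HasOrthFrame 0 q := by
  refine ⟨by rw [hr, zero_add], Sum.elim Fin.elim0 v, ?_, fun i => i.elim0, hneg⟩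
  rintro (i | i) (j | j) hij
  · exact i.elim0
  · exact i.elim0
  · exact j.elim0
  · exact hv i j (by simpa using hij)

theorem hasOrthFrame_U : U.HasOrthFrame 1 1 := by
  refine ⟨by rw [coordU.finrank_eq]; simp, Sum.elim (fun _ => vU 1 1) (fun _ => vU 1 (-1)),
    ?_, ?_, ?_⟩
  · rintro (i | i) (j | j) hij
    · exact absurd (congrArg _ (Subsingleton.elim i j)) hij
    · simp [form_vU, coordU_vU]
    · simp [form_vU, coordU_vU]
    · exact absurd (congrArg _ (Subsingleton.elim i j)) hij
  · intro i
    simp [form_vU, coordU_vU]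
  · intro i
    simp [form_vU, coordU_vU]

/-- Eight pairwise orthogonal roots of `E₈`. -/
def rootsE8 : Matrix (Fin 8) (Fin 8) ℤ :=
  !![0, 0, 0, 0, 0, 0, 1, 0;
     0, 1, 0, 0, 0, 0, 0, 0;
     1, 0, 0, 0, 0, 0, 0, 0;
     0, 0, 0, 0, 1, 0, 0, 0;
     1, 1, 2, 2, 1, 0, 0, 0;
     1, 1, 2, 2, 2, 2, 1, 0;
     1, 2, 2, 4, 3, 2, 1, 0;
     2, 3, 4, 6, 5, 4, 3, 2]

theorem rootsE8_gram : rootsE8 * CartanMatrix.E₈ * rootsE8.transpose = (2 : ℤ) • 1 := by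
  decide +kernel

theorem hasOrthFrame_E8 : (E8.rescale (-1)).HasOrthFrame 0 8 := by
  have key (i j : Fin 8) : (E8.rescale (-1)).form (rootsE8 i : Fin 8 → ℤ) (rootsE8 j : Fin 8 → ℤ) =
      -((2 : ℤ) • (1 : Matrix (Fin 8) (Fin 8) ℤ)) i j := by
    rw [← rootsE8_gram]
    change (-1) • Matrix.toBilin' CartanMatrix.E₈ (rootsE8 i) (rootsE8 j) = _
    rw [Matrix.toBilin'_apply', neg_one_smul, Matrix.mul_assoc]
    rfl
  refine HasOrthFrame.of_neg ?_ (fun i => (rootsE8 i : Fin 8 → ℤ)) (fun i j hij => ?_) (fun i => ?_)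
  · exact Module.finrank_fin_fun ℤ
  · rw [key]
    simp [Matrix.one_apply_ne hij]
  · rw [key]
    simp

theorem hasOrthFrame_A2 : (A2.rescale (-1)).HasOrthFrame 0 2 := by
  refine HasOrthFrame.of_neg (by rw [coordA.finrank_eq]; simp) ![vA 1 0, vA 1 2] ?_ ?_
  · intro i j hij
    fin_cases i <;> fin_cases j <;> simp [form_A2_neg, coordA_vA] at hij ⊢
  · intro i
    fin_cases i <;> simp [form_A2_neg, coordA_vA]

theorem hasOrthFrame_rankOne {k : ℤ} (hk : k < 0) : (rankOne k).HasOrthFrame 0 1 := by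
  refine HasOrthFrame.of_neg (by rw [(coordR k).finrank_eq]; simp) (fun _ => genR k) ?_ ?_
  · intro i j hij
    exact absurd (Subsingleton.elim i j) hij
  · intro i
    rw [form_rankOne, coordR_genR]
    lia

theorem hasOrthFrame_latQ {k : ℤ} (hk : 1 ≤ k) : ((latQ k).rescale (-1)).HasOrthFrame 0 3 := by
  -- The third vector is, up to sign, the one used for the generator of the discriminant group: it
  -- is orthogonal to the last two basis vectors.
  refine HasOrthFrame.of_neg (finrank_latQ k) ![vQ k 0 1 0, vQ k 0 1 2, vQ k 3 1 (-1)] ?_ ?_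
  · intro i j hij
    fin_cases i <;> fin_cases j <;> simp [form_latQ_neg, coordQ_vQ] at hij ⊢
  · intro i
    fin_cases i <;> simp [form_latQ_neg, coordQ_vQ]
    lia

theorem HasOrthFrame.twoUtwoE8 {S : EvenLattice} {q : ℕ} (hS : S.HasOrthFrame 0 q) :
    (twoUtwoE8 S).HasOrthFrame 2 (18 + q) := by
  have h := hasOrthFrame_U.sum (hasOrthFrame_U.sum (hasOrthFrame_E8.sum (hasOrthFrame_E8.sum hS)))
  have e : 1 + (1 + (8 + (8 + q))) = 18 + q := by lia
  rw [e] at h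
  exact h

end Signature

/-! ### Transport of `O⁺` along isometries -/

section Transport

variable {L M : EvenLattice}

theorem IsometryEquiv.symm_apply_apply (φ : L.form.IsometryEquiv M.form) (x : L) :
    φ.symm (φ x) = x := φ.toLinearEquiv.symm_apply_apply x

theorem IsometryEquiv.apply_symm_apply (φ : L.form.IsometryEquiv M.form) (x : M) :
    φ (φ.symm x) = x := φ.toLinearEquiv.apply_symm_apply x

/-- The isomorphism of orthogonal groups induced by an isometry. -/
def conjO (φ : L.form.IsometryEquiv M.form) : L.O ≃* M.O where
  toFun g := ⟨φ.toLinearEquiv.symm.trans (g.1.trans φ.toLinearEquiv), fun x y => by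
    change M.form (φ (g.1 (φ.symm x))) (φ (g.1 (φ.symm y))) = _
    rw [φ.map_app, g.2, φ.symm.map_app]⟩
  invFun g := ⟨φ.toLinearEquiv.trans (g.1.trans φ.toLinearEquiv.symm), fun x y => by
    change L.form (φ.symm (g.1 (φ x))) (φ.symm (g.1 (φ y))) = _
    rw [φ.symm.map_app, g.2, φ.map_app]⟩
  left_inv g := Subtype.ext <| LinearEquiv.ext fun x => by
    change φ.symm (φ (g.1 (φ.symm (φ x)))) = _
    rw [IsometryEquiv.symm_apply_apply, IsometryEquiv.symm_apply_apply]
  right_inv g := Subtype.ext <| LinearEquiv.ext fun x => by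
    change φ (φ.symm (g.1 (φ (φ.symm x)))) = _
    rw [IsometryEquiv.apply_symm_apply, IsometryEquiv.apply_symm_apply]
  map_mul' a b := Subtype.ext <| LinearEquiv.ext fun x => by
    change φ (a.1 (b.1 (φ.symm x))) = φ (a.1 (φ.symm (φ (b.1 (φ.symm x)))))
    rw [IsometryEquiv.symm_apply_apply]

theorem conjO_apply (φ : L.form.IsometryEquiv M.form) (g : L.O) (x : L) :
    (conjO φ g).1 (φ x) = φ (g.1 x) :=
  congrArg (fun y => φ (g.1 y)) (φ.toLinearEquiv.symm_apply_apply x)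

/-- The map of projective spaces induced by an isometry. -/
def projMap (φ : L.form.IsometryEquiv M.form) : L.PC → M.PC :=
  Projectivization.map (φ.toLinearEquiv.baseChange ℤ ℂ L M).toLinearMap
    (φ.toLinearEquiv.baseChange ℤ ℂ L M).injective

/-- Linear maps are continuous for the module topology, and continuity passes to the quotient
topology. -/
theorem continuous_projMap (φ : L.form.IsometryEquiv M.form) : Continuous (projMap φ) := by
  let _ : TopologicalSpace (ℂ ⊗[ℤ] L) := moduleTopology ℂ (ℂ ⊗[ℤ] L)
  let _ : TopologicalSpace (ℂ ⊗[ℤ] M) := moduleTopology ℂ (ℂ ⊗[ℤ] M)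
  have : IsModuleTopology ℂ (ℂ ⊗[ℤ] L) := ⟨rfl⟩
  have : IsModuleTopology ℂ (ℂ ⊗[ℤ] M) := ⟨rfl⟩
  have : ContinuousAdd (ℂ ⊗[ℤ] M) := IsModuleTopology.toContinuousAdd ℂ _
  have : ContinuousSMul ℂ (ℂ ⊗[ℤ] M) := IsModuleTopology.toContinuousSMul ℂ _
  have hc : Continuous (φ.toLinearEquiv.baseChange ℤ ℂ L M) :=
    IsModuleTopology.continuous_of_linearMap (φ.toLinearEquiv.baseChange ℤ ℂ L M).toLinearMap
  refine continuous_coinduced_dom.2 ?_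
  have h1 : Continuous (Projectivization.mk' (K := ℂ) (V := ℂ ⊗[ℤ] M)) := continuous_coinduced_rng
  exact h1.comp ((hc.comp continuous_subtype_val).subtype_mk fun v h =>
    Subtype.prop (p := (· ≠ (0 : ℂ ⊗[ℤ] L))) v
      ((φ.toLinearEquiv.baseChange ℤ ℂ L M).injective (h.trans (map_zero _).symm)))

theorem formC_isometry (φ : L.form.IsometryEquiv M.form) (v w : ℂ ⊗[ℤ] L) :
    M.form.baseChange ℂ (φ.toLinearEquiv.baseChange ℤ ℂ L M v)
      (φ.toLinearEquiv.baseChange ℤ ℂ L M w) = L.form.baseChange ℂ v w := by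
  induction v with
  | zero => simp
  | add a b ha hb => simp only [map_add, LinearMap.add_apply, ha, hb]
  | tmul a x =>
    induction w with
    | zero => simp
    | add c d hc hd => simp only [map_add, hc, hd]
    | tmul c y =>
      simp [LinearMap.BilinForm.baseChange_tmul]

theorem conj_isometry (φ : L.form.IsometryEquiv M.form) (v : ℂ ⊗[ℤ] L) :
    M.conj (φ.toLinearEquiv.baseChange ℤ ℂ L M v) =
      φ.toLinearEquiv.baseChange ℤ ℂ L M (L.conj v) := by
  induction v with
  | zero => simp
  | tmul a x => rfl
  | add a b ha hb => simp only [map_add, ha, hb]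

theorem projMap_mem (φ : L.form.IsometryEquiv M.form) {p : L.PC} (hp : p ∈ L.Omega) :
    projMap φ p ∈ M.Omega := by
  obtain ⟨v, hv, rfl, h0, h1⟩ := hp
  refine ⟨φ.toLinearEquiv.baseChange ℤ ℂ L M v, fun h => hv
    ((φ.toLinearEquiv.baseChange ℤ ℂ L M).injective (h.trans (map_zero _).symm)), rfl, ?_, ?_⟩
  · rw [formC_isometry, h0]
  · rw [conj_isometry, formC_isometry]
    exact h1

theorem projMap_mem_connectedComponentIn (φ : L.form.IsometryEquiv M.form) {p q : L.PC}
    (hp : p ∈ L.Omega) (hq : q ∈ connectedComponentIn L.Omega p) :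
    projMap φ q ∈ connectedComponentIn M.Omega (projMap φ p) := by
  have h1 := (continuous_projMap φ).continuousOn.image_connectedComponentIn_subset
    (s := L.Omega) hp (Set.mem_image_of_mem _ hq)
  refine connectedComponentIn_mono _ ?_ h1
  rintro _ ⟨r, hr, rfl⟩
  exact projMap_mem φ hr

theorem projAct_conjO (φ : L.form.IsometryEquiv M.form) (g : L.O) (p : L.PC) :
    M.projAct (conjO φ g) (projMap φ p) = projMap φ (L.projAct g p) := by
  induction p using Projectivization.ind with
  | h v hv =>
    simp only [projAct, projMap, Projectivization.map_mk]
    congr 1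
    change (conjO φ g).1.baseChange ℤ ℂ M M (φ.toLinearEquiv.baseChange ℤ ℂ L M v) =
      φ.toLinearEquiv.baseChange ℤ ℂ L M (g.1.baseChange ℤ ℂ L L v)
    clear hv
    induction v with
    | zero => simp
    | add a b ha hb => simp only [map_add, ha, hb]
    | tmul a x => exact congrArg (fun y => a ⊗ₜ[ℤ] y) (conjO_apply φ g x)

theorem projMap_symm (φ : L.form.IsometryEquiv M.form) (p : M.PC) :
    projMap φ (projMap φ.symm p) = p := by
  induction p using Projectivization.ind with
  | h v hv =>
    simp only [projMap, Projectivization.map_mk]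
    congr 1
    change φ.toLinearEquiv.baseChange ℤ ℂ L M (φ.symm.toLinearEquiv.baseChange ℤ ℂ M L v) = v
    clear hv
    induction v with
    | zero => simp
    | add a b ha hb => simp only [map_add, ha, hb]
    | tmul a x =>
      exact congrArg (fun y => a ⊗ₜ[ℤ] y) (φ.toLinearEquiv.apply_symm_apply x)

/-- An isometry carries connected components of `Ω(L)` into those of `Ω(M)`, so the `O⁺` condition
can be transported to a model of the complement. -/
theorem conjO_mem_Oplus (φ : L.form.IsometryEquiv M.form) {g : L.O} (hg : g ∈ L.Oplus) :
    conjO φ g ∈ M.Oplus := by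
  intro p hp
  have h1 := projMap_mem φ.symm hp
  have h2 := projMap_mem_connectedComponentIn φ h1 (hg _ h1)
  rwa [← projAct_conjO, projMap_symm] at h2

theorem conjO_mem_Oplus_iff (φ : L.form.IsometryEquiv M.form) (g : L.O) :
    conjO φ g ∈ M.Oplus ↔ g ∈ L.Oplus := by
  refine ⟨fun h => ?_, conjO_mem_Oplus φ⟩
  have h1 := conjO_mem_Oplus φ.symm h
  have h2 : conjO φ.symm (conjO φ g) = g := (conjO φ).symm_apply_apply g
  rwa [h2] at h1

end Transport

/-! ### Extension of isometries from an orthogonal complement -/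

section Extension

variable {L : EvenLattice}

/-- The multiple `(h, h) x - (h, x) h` of the projection of `x` to `h^⊥`. -/
def projPerp (L : EvenLattice) (h : L) : L →ₗ[ℤ] L.perp h :=
  liftPerp (L.form h h • LinearMap.id - (L.form h).smulRight h) fun z => by
    simp only [LinearMap.sub_apply, LinearMap.smul_apply, LinearMap.id_apply,
      LinearMap.smulRight_apply, map_sub, map_smul, smul_eq_mul]
    ring

theorem perpVal_projPerp (h x : L) :
    perpVal (projPerp L h x) = L.form h h • x - L.form h x • h := rfl

theorem perpVal_smul {h : L} (c : ℤ) (x : L.perp h) : perpVal (c • x) = c • perpVal x :=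
  map_smul (perpIncl L h) c x

theorem perpVal_sub {h : L} (x y : L.perp h) : perpVal (x - y) = perpVal x - perpVal y :=
  map_sub (perpIncl L h) x y

theorem projPerp_perpVal {h : L} (x : L.perp h) : projPerp L h (perpVal x) = L.form h h • x := by
  apply perpVal_injective
  rw [perpVal_projPerp, form_perpVal, zero_smul, sub_zero, perpVal_smul]

theorem form_projPerp_left {h : L} (x : L) (y : L.perp h) :
    (L.perp h).form (projPerp L h x) y = L.form h h * L.form x (perpVal y) := by
  rw [form_perp, perpVal_projPerp, map_sub, map_smul, map_smul, LinearMap.sub_apply,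
    LinearMap.smul_apply, LinearMap.smul_apply, form_perpVal, smul_zero, sub_zero, smul_eq_mul]

theorem smul_eq_add_projPerp (h x : L) :
    L.form h h • x = L.form h x • h + perpVal (projPerp L h x) := by
  rw [perpVal_projPerp]
  abel

/-- The isometry `γ` of `h^⊥` acts trivially on the projections of vectors of `L`, modulo `h^⊥`. -/
def FixesProj {h : L} (γ : (L.perp h).O) : Prop :=
  ∀ x : L, ∃ l : L.perp h, γ.1 (projPerp L h x) - projPerp L h x = L.form h h • l

theorem perpVal_restrictPerp {h : L} (g : L.Ofix h) (x : L.perp h) :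
    perpVal ((L.restrictPerp h g).1 x) = g.1.1 (perpVal x) := rfl

theorem form_fix {h : L} (g : L.Ofix h) (x : L) : L.form h (g.1.1 x) = L.form h x := by
  have h1 : g.1.1 h = h := g.2
  have h2 := g.1.2 h x
  rwa [h1] at h2

/-- Since `g` fixes `h`, the vector `g x - x` lies in `h^⊥`, and `P(g x) - P x` is `(h,h)` times it.
-/
theorem fixesProj_restrictPerp {h : L} (g : L.Ofix h) : FixesProj (L.restrictPerp h g) := by
  intro x
  refine ⟨mkPerp (g.1.1 x - x) (by rw [map_sub, form_fix, sub_self]), ?_⟩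
  have h1 : g.1.1 h = h := g.2
  apply perpVal_injective
  rw [perpVal_sub, perpVal_smul, perpVal_mkPerp, perpVal_restrictPerp, perpVal_projPerp, map_sub,
    map_smul, map_smul, h1]
  module

/-- `(h,h) x` lies in `ℤ h + h^⊥`, and `L` is torsion-free. -/
theorem restrictPerp_injective {h : L} (hh : L.form h h ≠ 0) :
    Function.Injective (L.restrictPerp h) := by
  intro g g' hgg
  refine Subtype.ext (Subtype.ext (LinearEquiv.ext fun x => ?_))
  have h1 : g.1.1 h = h := g.2
  have h2 : g'.1.1 h = h := g'.2
  apply smul_right_injective L hh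
  change L.form h h • g.1.1 x = L.form h h • g'.1.1 x
  rw [← map_smul, ← map_smul, smul_eq_add_projPerp, map_add, map_add, map_smul, map_smul, h1, h2,
    ← perpVal_restrictPerp, ← perpVal_restrictPerp, hgg]

theorem FixesProj.exists_linearMap {h : L} (hh : L.form h h ≠ 0) {γ : (L.perp h).O}
    (hγ : FixesProj γ) : ∃ T : L →ₗ[ℤ] L.perp h,
      ∀ x, L.form h h • T x = γ.1 (projPerp L h x) - projPerp L h x := by
  choose l hl using hγ
  have hinj := smul_right_injective (L.perp h) hh
  refine ⟨AddMonoidHom.toIntLinearMap (AddMonoidHom.mk' l fun x y => hinj ?_), fun x => (hl x).symm⟩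
  change L.form h h • l (x + y) = L.form h h • (l x + l y)
  rw [smul_add, ← hl, ← hl, ← hl, map_add, map_add]
  abel

theorem FixesProj.symm {h : L} {γ : (L.perp h).O} (hγ : FixesProj γ) : FixesProj γ⁻¹ := by
  intro x
  obtain ⟨l, hl⟩ := hγ x
  refine ⟨-γ.1.symm l, ?_⟩
  change γ.1.symm (projPerp L h x) - projPerp L h x = _
  rw [smul_neg, ← map_smul, ← hl, map_sub, LinearEquiv.symm_apply_apply]
  abel

/-- The map `x ↦ x + T x` extends `γ` if `(h, h) T x = γ (P x) - P x`. -/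
theorem extension_props {h : L} {γ : (L.perp h).O} {T : L →ₗ[ℤ] L.perp h}
    (hT : ∀ x, L.form h h • T x = γ.1 (projPerp L h x) - projPerp L h x) (x : L) :
    L.form h (x + perpVal (T x)) = L.form h x ∧
      projPerp L h (x + perpVal (T x)) = γ.1 (projPerp L h x) := by
  refine ⟨by rw [map_add, form_perpVal, add_zero], ?_⟩
  rw [map_add, projPerp_perpVal, hT]
  abel

/-- The rational extension `id ⊕ γ` is `x ↦ x + T x` with `T = (γ P - P)/(h,h)`, and the hypothesis
makes `T` integral. The inverse comes from `γ⁻¹`; identities are checked after multiplication by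
`(h,h)`. -/
theorem FixesProj.exists_extension {h : L} (hh : L.form h h ≠ 0) {γ : (L.perp h).O}
    (hγ : FixesProj γ) : ∃ g : L.Ofix h, L.restrictPerp h g = γ := by
  obtain ⟨T, hT⟩ := hγ.exists_linearMap hh
  obtain ⟨T', hT'⟩ := hγ.symm.exists_linearMap hh
  have hn : ∀ {γ : (L.perp h).O} {T : L →ₗ[ℤ] L.perp h},
      (∀ x, L.form h h • T x = γ.1 (projPerp L h x) - projPerp L h x) → ∀ x,
      L.form h h • (x + perpVal (T x)) = L.form h x • h + perpVal (γ.1 (projPerp L h x)) := by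
    intro γ T hT x
    rw [smul_eq_add_projPerp, (extension_props hT x).1, (extension_props hT x).2]
  have hinj := smul_right_injective L hh
  have hinv : ∀ {γ γ' : (L.perp h).O} {T T' : L →ₗ[ℤ] L.perp h},
      (∀ x, L.form h h • T x = γ.1 (projPerp L h x) - projPerp L h x) →
      (∀ x, L.form h h • T' x = γ'.1 (projPerp L h x) - projPerp L h x) →
      (∀ y, γ'.1 (γ.1 y) = y) → ∀ x,
      (x + perpVal (T x)) + perpVal (T' (x + perpVal (T x))) = x := by
    intro γ γ' T T' hT hT' hγγ x
    apply hinj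
    change L.form h h • _ = L.form h h • x
    rw [hn hT', (extension_props hT x).1, (extension_props hT x).2, hγγ, ← smul_eq_add_projPerp]
  let e : L ≃ₗ[ℤ] L := LinearEquiv.ofLinearMap (LinearMap.id + perpIncl L h ∘ₗ T)
    (LinearMap.id + perpIncl L h ∘ₗ T')
    (LinearMap.ext fun x => hinv hT' hT (fun y => γ.1.apply_symm_apply y) x)
    (LinearMap.ext fun x => hinv hT hT' (fun y => γ.1.symm_apply_apply y) x)
  have he : ∀ x, e x = x + perpVal (T x) := fun _ => rfl
  have hiso : ∀ x y, L.form (e x) (e y) = L.form x y := by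
    intro x y
    have h1 : L.form (L.form h h • e x) (L.form h h • e y) =
        L.form (L.form h h • x) (L.form h h • y) := by
      rw [he, he, hn hT, hn hT, smul_eq_add_projPerp h x, smul_eq_add_projPerp h y]
      have h2 := γ.2 (projPerp L h x) (projPerp L h y)
      rw [form_perp, form_perp] at h2
      have h3 : ∀ z : L.perp h, L.form (perpVal z) h = 0 := fun z => by
        rw [L.symm, form_perpVal]
      simp only [map_add, map_smul, LinearMap.add_apply, LinearMap.smul_apply, form_perpVal, h3,
        h2]
    simp only [map_smul, LinearMap.smul_apply, smul_eq_mul] at h1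
    exact mul_left_cancel₀ hh (mul_left_cancel₀ hh h1)
  refine ⟨⟨⟨e, hiso⟩, ?_⟩, ?_⟩
  · change e h = h
    apply hinj
    change L.form h h • e h = L.form h h • h
    have h1 : projPerp L h h = 0 := by
      apply perpVal_injective
      rw [perpVal_projPerp, sub_self]
      rfl
    rw [he, hn hT, h1, map_zero]
    exact add_zero _
  · refine Subtype.ext (LinearEquiv.ext fun x => perpVal_injective ?_)
    change e (perpVal x) = _
    apply hinj
    change L.form h h • e (perpVal x) = L.form h h • _
    rw [he, hn hT, form_perpVal, zero_smul, zero_add, projPerp_perpVal, map_smul, perpVal_smul]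

theorem mem_OplusFix {h : L} (g : L.O) : g ∈ L.OplusFix h ↔
    ∃ hg : g ∈ L.Ofix h, L.restrictPerp h ⟨g, hg⟩ ∈ (L.perp h).Oplus := by
  constructor
  · rintro ⟨g', hg', rfl⟩
    exact ⟨g'.2, hg'⟩
  · rintro ⟨hg, h1⟩
    exact ⟨⟨g, hg⟩, h1, rfl⟩

theorem OplusFix_le {h : L} : L.OplusFix h ≤ L.Ofix h := fun g hg => ((mem_OplusFix g).1 hg).1

/-- Restriction identifies `O⁺(L, h)` with the group of those elements of `O⁺(h^⊥)` that fix the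
projections of vectors of `L`. -/
theorem exists_mulEquiv_OplusFix {h : L} (hh : L.form h h ≠ 0) {K : EvenLattice}
    (e : (L.perp h).O ≃* K.O) (T : Subgroup K.O)
    (hT : ∀ γ, e γ ∈ T ↔ γ ∈ (L.perp h).Oplus ∧ FixesProj γ) :
    ∃ Φ : L.OplusFix h ≃* T, ∀ g : L.OplusFix h,
      (Φ g).1 = e (L.restrictPerp h ⟨g.1, OplusFix_le g.2⟩) := by
  let f : L.OplusFix h →* T :=
    { toFun := fun g => ⟨e (L.restrictPerp h ⟨g.1, OplusFix_le g.2⟩), by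
        rw [hT]
        exact ⟨((mem_OplusFix g.1).1 g.2).2, fixesProj_restrictPerp _⟩⟩
      map_one' := Subtype.ext ((congrArg e (map_one (L.restrictPerp h))).trans (map_one e))
      map_mul' := fun a b => Subtype.ext ((congrArg e (map_mul (L.restrictPerp h)
        ⟨a.1, OplusFix_le a.2⟩ ⟨b.1, OplusFix_le b.2⟩)).trans (map_mul e _ _)) }
  have hf : ∀ g, (f g).1 = e (L.restrictPerp h ⟨g.1, OplusFix_le g.2⟩) := fun _ => rfl
  refine ⟨MulEquiv.ofBijective f ⟨fun a b hab => ?_, fun t => ?_⟩, hf⟩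
  · have h1 := congrArg Subtype.val hab
    rw [hf, hf] at h1
    exact Subtype.ext (congrArg (fun x : L.Ofix h => x.1) (restrictPerp_injective hh (e.injective h1)))
  · obtain ⟨γ, hγ⟩ := e.surjective t.1
    have h1 := (hT γ).1 (hγ ▸ t.2)
    obtain ⟨g, hg⟩ := h1.2.exists_extension hh
    refine ⟨⟨g.1, (mem_OplusFix _).2 ⟨g.2, hg ▸ h1.1⟩⟩, Subtype.ext ?_⟩
    rw [hf, ← hγ]
    exact congrArg e hg

end Extension

/-! ### The action on the discriminant group -/

section Action

variable {L M : EvenLattice}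

theorem discAct_toD_eq_iff (g : L.O) {β : ℤ} (hβ : β ≠ 0) (m : L) (h) :
    L.discAct g (L.toD ⟨L.frac β m, h⟩) = L.toD ⟨L.frac β m, h⟩ ↔ ∃ l : L, g.1 m - m = β • l := by
  have h1 : L.discAct g (L.toD ⟨L.frac β m, h⟩) = L.toD (dualMap (g.1 : L →ₗ[ℤ] L)
      ⟨(g.1.symm : L →ₗ[ℤ] L), fun x y => by simpa using g.2 x (g.1.symm y)⟩
      ⟨L.frac β m, h⟩) := rfl
  rw [h1, toD_eq_iff]
  refine exists_congr fun l => ?_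
  rw [coe_dualMap, baseChange_frac, ← frac_sub, eq_comm, frac_eq_toRat_iff hβ]
  rfl

theorem mem_stableO_iff (g : L.O) : g ∈ L.stableO ↔ ∀ x, L.discAct g x = x :=
  DFunLike.ext_iff (f := L.discAct g) (g := 1)

/-- `FixesProj` means that `γ` fixes the classes `P x / (h,h)`. If `(h, x₀) = div(h)`, primitivity
of `h` makes the order of the class of `x₀` a multiple of `(h,h)/div(h) = N`, so this class alone
generates `D(h^⊥)`. -/
theorem fixesProj_iff_of_card {h : L} (hp : IsPrimitive h) (hh : L.form h h ≠ 0) {N : ℕ}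
    (hN : L.form h h = divisor h * N) (hcard : Nat.card (L.perp h).D = N) (γ : (L.perp h).O) :
    γ ∈ (L.perp h).stableO ↔ FixesProj γ := by
  have hmem : ∀ x, (L.perp h).frac (L.form h h) (projPerp L h x) ∈ (L.perp h).dual := fun x =>
    (frac_mem_dual hh _).2 fun l => ⟨L.form x (perpVal l), form_projPerp_left x l⟩
  rw [mem_stableO_iff]
  constructor
  · intro H x
    exact (discAct_toD_eq_iff γ hh _ (hmem x)).1 (H _)
  · intro H
    obtain ⟨x₀, hx₀⟩ := exists_form_eq_divisor h
    obtain ⟨a, ha⟩ : ∃ a, a = toD _ ⟨_, hmem x₀⟩ := ⟨_, rfl⟩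
    have hfix : (L.perp h).discAct γ a = a := by
      rw [ha, discAct_toD_eq_iff γ hh]
      exact H x₀
    have hdiv0 : (divisor h : ℤ) ≠ 0 := fun h0 => hh (by rw [hN, h0, zero_mul])
    have hN0 : N ≠ 0 := fun h0 => hh (by rw [hN, h0]; simp)
    have hord : N ∣ addOrderOf a := by
      have h1 : addOrderOf a • a = 0 := addOrderOf_nsmul_eq_zero a
      rw [ha, ← map_nsmul, ← natCast_zsmul, toD_eq_zero] at h1
      obtain ⟨l, hl⟩ := h1
      rw [AddSubgroupClass.coe_zsmul, ← frac_smul, eq_comm, frac_eq_toRat_iff hh] at hl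
      have h2 := congrArg perpVal hl
      rw [perpVal_smul, perpVal_smul, perpVal_projPerp, hx₀, ← ha] at h2
      -- If `n a = 0`, then `n div(h) h` is divisible by `(h,h)` in `L`; primitivity gives `(h,h) ∣
      -- n div(h)`, that is, `N ∣ n`.
      have h3 : ((addOrderOf a : ℤ) * divisor h) • h =
          L.form h h • ((addOrderOf a : ℤ) • x₀ - perpVal l) := by
        rw [smul_sub, ← h2]
        module
      have h4 := hp.dvd_of_smul_eq hh h3
      rw [hN, mul_comm (addOrderOf a : ℤ)] at h4
      exact_mod_cast (mul_dvd_mul_iff_left hdiv0).1 h4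
    have hfin : Finite (L.perp h).D := Nat.finite_of_card_ne_zero (by rw [hcard]; exact hN0)
    have htop : AddSubgroup.zmultiples a = ⊤ := by
      apply AddSubgroup.eq_top_of_le_card
      rw [hcard, Nat.card_zmultiples]
      exact Nat.le_of_dvd (addOrderOf_pos a) hord
    intro x
    obtain ⟨j, rfl⟩ := AddSubgroup.mem_zmultiples_iff.1 (htop ▸ AddSubgroup.mem_top x)
    rw [map_zsmul, hfix]

theorem fixes_discInr_iff {k : ℤ} (hk : k ≠ 0) (g : (M ⊞ rankOne k).O) :
    (∀ x, (M ⊞ rankOne k).discAct g (discInr M (rankOne k) x) = discInr M (rankOne k) x) ↔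
      ∃ z, g.1 (inrSum M (rankOne k) (genR k)) - inrSum M (rankOne k) (genR k) = (2 * k) • z := by
  have hk2 : 2 * k ≠ 0 := mul_ne_zero two_ne_zero hk
  have hmem : (M ⊞ rankOne k).frac (2 * k) (inrSum M (rankOne k) (genR k)) ∈
      (M ⊞ rankOne k).dual := by
    rw [frac_mem_dual hk2]
    intro l
    rw [form_inr_left]
    exact (frac_mem_dual hk2 _).1 (genR_mem_dual hk) _
  have h1 : discInr M (rankOne k) (toD _ ⟨_, genR_mem_dual hk⟩) = toD _ ⟨_, hmem⟩ := rfl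
  rw [← discAct_toD_eq_iff g hk2 _ hmem, ← h1]
  refine ⟨fun H => H _, fun H x => ?_⟩
  obtain ⟨j, rfl⟩ := exists_generator_rankOne hk (genR_mem_dual hk) x
  rw [map_zsmul, map_zsmul, H]

/-- In the model, `P x` is `2k` times a vector of `M` plus a multiple `c(x)` of the generator of
`⟨-2k⟩`. Modulo `(h,h) = 2k` only the generator matters, and this is the condition for acting
trivially on `D(⟨-2k⟩)`. -/
theorem fixesProj_iff_fixes_discInr (ψ : L.form.IsometryEquiv (U ⊞ M).form) {h : L} {k : ℤ}
    (hk : k ≠ 0) (hψ : ψ h = inlSum U M (vU k 1)) (γ : (L.perp h).O) :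
    (∀ x, (M ⊞ rankOne (-k)).discAct (conjO (perpIsometryU ψ h k hψ) γ)
      (discInr M (rankOne (-k)) x) = discInr M (rankOne (-k)) x) ↔ FixesProj γ := by
  obtain ⟨φ, hφ⟩ : ∃ φ, φ = perpIsometryU ψ h k hψ := ⟨_, rfl⟩
  have hh : L.form h h = 2 * k := by
    rw [← ψ.map_app, hψ, form_inl_left, fst_inl, form_vU, coordU_vU]
    simp
    ring
  have hproj : ∀ x, φ (projPerp L h x) = (2 * k) • inlSum M (rankOne (-k)) (sndSum U M (ψ x)) +
      (k * coordU (fstSum U M (ψ x)) 1 - coordU (fstSum U M (ψ x)) 0) •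
        inrSum M (rankOne (-k)) (genR (-k)) := by
    intro x
    have h1 : L.form h x =
        k * coordU (fstSum U M (ψ x)) 1 + coordU (fstSum U M (ψ x)) 0 := by
      rw [← ψ.map_app, hψ, form_inl_left, form_vU, one_mul]
    have h2 : φ (projPerp L h x) = perpRetractU M k (ψ (L.form h h • x - L.form h x • h)) := by
      rw [hφ]; rfl
    rw [h2, map_sub, map_smul, map_smul, hψ, h1, hh, map_sub, map_smul, map_smul,
      perpRetractU_apply, perpRetractU_apply, fst_inl, snd_inl, coordU_vU]
    simp only [map_smul, map_zero, zero_add, Matrix.cons_val_one, Matrix.cons_val_fin_one, one_smul]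
    module
  rw [← hφ, fixes_discInr_iff (neg_ne_zero.2 hk)]
  constructor
  · rintro ⟨z, hz⟩ x
    obtain ⟨c, hc⟩ : ∃ c, c = k * coordU (fstSum U M (ψ x)) 1 - coordU (fstSum U M (ψ x)) 0 :=
      ⟨_, rfl⟩
    obtain ⟨s, hs⟩ : ∃ s, s = inlSum M (rankOne (-k)) (sndSum U M (ψ x)) := ⟨_, rfl⟩
    refine ⟨φ.symm ((conjO φ γ).1 s - s - c • z), ?_⟩
    have h1 := hproj x
    rw [← hc, ← hs] at h1
    apply φ.toLinearEquiv.injective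
    change φ (γ.1 (projPerp L h x) - projPerp L h x) = φ (L.form h h • φ.symm _)
    rw [map_sub, map_smul, IsometryEquiv.apply_symm_apply, ← conjO_apply, h1, map_add, map_smul,
      map_smul, hh]
    have h2 : (conjO φ γ).1 (inrSum M (rankOne (-k)) (genR (-k))) =
        inrSum M (rankOne (-k)) (genR (-k)) + (2 * -k) • z := by
      rw [← hz]; abel
    rw [h2]
    module
  · intro H
    -- For `x = -e` the coefficient is `c(x) = 1`, so `P x` is the generator itself.
    obtain ⟨x, hx⟩ : ∃ x, x = ψ.symm (inlSum U M (vU (-1) 0)) := ⟨_, rfl⟩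
    have h1 := hproj x
    rw [hx, IsometryEquiv.apply_symm_apply, snd_inl, fst_inl, coordU_vU, ← hx, map_zero] at h1
    simp only [smul_zero, zero_add, Matrix.cons_val_one, Matrix.cons_val_zero,
      Matrix.cons_val_fin_one, mul_zero, sub_neg_eq_add, one_smul] at h1
    obtain ⟨l, hl⟩ := H x
    refine ⟨-φ l, ?_⟩
    rw [← h1, conjO_apply, ← map_sub, hl, map_smul, hh]
    module

/-- A group with compatible homomorphisms to `D(A₂(-1))` and `D(⟨2k⟩)`, jointly injective, on which
the sum of the quadratic forms vanishes, is cyclic. -/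
theorem isAddCyclic_of_isotropic {A : Type*} [AddCommGroup A] {k : ℤ} (hk : k ≠ 0)
    (f : A →+ (A2.rescale (-1)).D) (g : A →+ (rankOne k).D)
    (hinj : ∀ a, f a = 0 → g a = 0 → a = 0)
    (hq : ∀ a, (A2.rescale (-1)).q (f a) + (rankOne k).q (g a) = 0) : IsAddCyclic A := by
  have := isAddCyclic_rankOne hk
  -- If `g a = 0`, isotropy makes `f a` isotropic in `D(A₂(-1))`, hence zero. So `g` embeds the
  -- group into a cyclic one.
  refine isAddCyclic_of_injective g ((injective_iff_map_eq_zero g).2 fun a ha => hinj a ?_ ha)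
  have h1 := hq a
  rw [ha, q_zero, add_zero] at h1
  exact eq_zero_of_q_A2 _ h1

end Action

/-! ### The main theorem -/

section Main

variable {h : (U ⊞ MA : EvenLattice)} {d : ℕ}

theorem isotropic_isAddCyclic (hd : 0 < d)
    (H : AddSubgroup ((A2.rescale (-1)).D × (rankOne (-d)).D))
    (hH : ∀ x ∈ H, (A2.rescale (-1)).q x.1 + (rankOne (-d)).q x.2 = 0) : IsAddCyclic H :=
  isAddCyclic_of_isotropic (by lia) ((AddMonoidHom.fst _ _).comp H.subtype)
    ((AddMonoidHom.snd _ _).comp H.subtype)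
    (fun _ h1 h2 => Subtype.ext (Prod.ext h1 h2)) fun a => hH a.1 a.2

theorem perp_of_divisor_one (hd : 0 < d) (ψ : (U ⊞ MA).O) (hψ : ψ.1 h = inlSum U MA (vU d 1)) :
    (∃ (φ : ((U ⊞ MA).perp h).form.IsometryEquiv (MA ⊞ rankOne (-d)).form)
      (Φ : (U ⊞ MA).OplusFix h ≃* OplusTrivialOnRight MA (rankOne (-d))),
      ∀ (g : (U ⊞ MA).OplusFix h) (x : (U ⊞ MA).perp h),
        perpVal (φ.symm ((Φ g).1.1 (φ x))) = g.1.1 (perpVal x)) ∧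
    Nonempty (DiscSumIso ((U ⊞ MA).perp h) (A2.rescale (-1)) (rankOne (-d))) ∧
    (∀ H : AddSubgroup ((U ⊞ MA).perp h).D,
      (∀ x ∈ H, ((U ⊞ MA).perp h).q x = 0) → IsAddCyclic H) ∧
    ((U ⊞ MA).perp h).HasSignature 2 21 := by
  have hd' : (d : ℤ) ≠ 0 := by lia
  have hψ' : isometryOfO ψ h = inlSum U MA (vU d 1) := hψ
  have hh : (U ⊞ MA).form h h ≠ 0 := by
    rw [← ψ.2, hψ, form_inl_left, fst_inl, form_vU, coordU_vU]
    simp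
    lia
  have s : DiscSumIso ((U ⊞ MA).perp h) (A2.rescale (-1)) (rankOne (-d)) :=
    (DiscSumIso.sum MA (rankOne (-d))).congr
      (DiscIso.ofIsometry (perpIsometryU (isometryOfO ψ) h d hψ')) (DiscIso.twoUtwoE8 _)
      (DiscIso.refl _)
  refine ⟨?_, ⟨s⟩, fun H hH => ?_, ?_⟩
  · obtain ⟨Φ, hΦ⟩ := exists_mulEquiv_OplusFix hh
      (conjO (perpIsometryU (isometryOfO ψ) h d hψ')) (OplusTrivialOnRight MA (rankOne (-d)))
      fun γ => and_congr (conjO_mem_Oplus_iff _ γ)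
        (fixesProj_iff_fixes_discInr (isometryOfO ψ) hd' hψ' γ)
    refine ⟨perpIsometryU (isometryOfO ψ) h d hψ', Φ, fun g x => ?_⟩
    rw [hΦ, conjO_apply, IsometryEquiv.symm_apply_apply, perpVal_restrictPerp]
  · refine isAddCyclic_of_isotropic (k := -d) (by lia)
      ((AddMonoidHom.fst _ _).comp (s.toEquiv.toAddMonoidHom.comp H.subtype))
      ((AddMonoidHom.snd _ _).comp (s.toEquiv.toAddMonoidHom.comp H.subtype))
      (fun a h1 h2 => Subtype.ext (s.toEquiv.injective ?_)) fun a => ?_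
    · rw [ZeroMemClass.coe_zero, map_zero]
      exact Prod.ext h1 h2
    · exact (s.map_q a.1).trans (hH a.1 a.2)
  · have h1 : (MA ⊞ rankOne (-d)).HasOrthFrame 2 (18 + 2 + 1) :=
      (hasOrthFrame_A2.twoUtwoE8).sum (hasOrthFrame_rankOne (by lia))
    exact (h1.of_isometry (perpIsometryU (isometryOfO ψ) h d hψ')).hasSignature

theorem perp_of_divisor_three (hprim : IsPrimitive h) (hsq : (U ⊞ MA).form h h = 2 * (d : ℤ))
    (hdiv : divisor h = 3) {k : ℤ} (hk : 1 ≤ k) (hd : (d : ℤ) = 9 * k - 3) (ψ : (U ⊞ MA).O)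
    (hψ : ψ.1 h = inlSum U MA (vU (3 * k) 3) + inrSum U MA (ofS _ vA2)) :
    ((U ⊞ MA).perp h).HasSignature 2 21 ∧
    (∃ Q : EvenLattice,
      Module.finrank ℤ (Q.rescale (-1)) = 3 ∧
      (Q.rescale (-1)).IsNegDef ∧
      3 * (Q.rescale (-1)).det = -(2 * (d : ℤ)) ∧
      ((U ⊞ MA).perp h).form.Equivalent (twoUtwoE8 (Q.rescale (-1))).form ∧
      Nonempty (DiscIso (Q.rescale (-1)) ((U ⊞ MA).perp h)) ∧
      IsAddCyclic (Q.rescale (-1)).D ∧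
      3 * Nat.card (Q.rescale (-1)).D = 2 * d) ∧
    (∃ Φ : (U ⊞ MA).OplusFix h ≃* ((U ⊞ MA).perp h).stableOplus,
      ∀ (g : (U ⊞ MA).OplusFix h) (x : (U ⊞ MA).perp h),
        perpVal ((Φ g).1.1 x) = g.1.1 (perpVal x)) ∧
    (∀ H : AddSubgroup ((U ⊞ MA).perp h).D,
      (∀ x ∈ H, ((U ⊞ MA).perp h).q x = 0) → IsAddCyclic H) := by
  have hh : (U ⊞ MA).form h h ≠ 0 := by rw [hsq]; lia
  obtain ⟨N, hN⟩ : ∃ N : ℕ, (N : ℤ) = 6 * k - 2 := ⟨(6 * k - 2).toNat, by lia⟩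
  have hψ' : (isometryOfO ψ).trans (sumIsometry U (splitS (A2.rescale (-1)))) h =
      inlSum U (latV ⊞ A2.rescale (-1)) (vU (3 * k) 3) +
        inrSum U (latV ⊞ A2.rescale (-1)) (inrSum latV (A2.rescale (-1)) vA2) := by
    change sumIsometry U (splitS (A2.rescale (-1))) (ψ.1 h) = _
    rw [hψ, sumIsometry_apply, fst_inl_add_inr, snd_inl_add_inr, splitS_ofS]
  have φ : ((U ⊞ MA).perp h).form.IsometryEquiv (twoUtwoE8 ((latQ k).rescale (-1))).form :=
    (perpIsometryQ _ h k hψ').trans (splitS _).symm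
  have e : DiscIso ((latQ k).rescale (-1)) ((U ⊞ MA).perp h) :=
    ((DiscIso.ofIsometry φ).trans (DiscIso.twoUtwoE8 _)).symm
  obtain ⟨a, ha, ha'⟩ := exists_generator_latQ k
  rw [← hN] at ha'
  have hcyc : IsAddCyclic ((latQ k).rescale (-1)).D := isAddCyclic_of_generator a ha
  have hcard : Nat.card ((latQ k).rescale (-1)).D = N := card_of_generator a ha ha'
  have hcard' : Nat.card ((U ⊞ MA).perp h).D = N := by
    rw [← hcard]
    exact (Nat.card_congr e.toEquiv.toEquiv).symm
  refine ⟨?_, ⟨latQ k, finrank_latQ k, isNegDef_latQ hk, ?_, ⟨φ⟩, ⟨e⟩, hcyc, ?_⟩, ?_, ?_⟩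
  · exact ((hasOrthFrame_latQ hk).twoUtwoE8.of_isometry φ).hasSignature
  · rw [det_latQ]
    lia
  · rw [hcard]
    lia
  -- Here `(h,h) = 18k - 6 = 3N` with `N = 6k - 2` the order of `D(h^⊥)`, so the order count
  -- applies.
  · obtain ⟨Φ, hΦ⟩ := exists_mulEquiv_OplusFix hh (MulEquiv.refl _)
      ((U ⊞ MA).perp h).stableOplus fun γ => by
        rw [and_comm, ← fixesProj_iff_of_card hprim hh (N := N) (by rw [hdiv, hsq]; lia) hcard' γ]
        rfl
    refine ⟨Φ, fun g x => ?_⟩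
    rw [hΦ]
    rfl
  -- The whole discriminant group is cyclic, hence so are its subgroups.
  · intro H _
    have : IsAddCyclic ((U ⊞ MA).perp h).D :=
      isAddCyclic_of_surjective e.toEquiv e.toEquiv.surjective
    infer_instance

end Main

end EvenLattice

end

open EvenLattice in
theorem theorem3p1 (d : ℕ) (hd : 0 < d) (h : LA) (hprim : IsPrimitive h)
    (hsq : LA.form h h = 2 * (d : ℤ)) :
    (LA.perp h).HasSignature 2 21 ∧
    (divisor h = 3 →
      (∃ Q : EvenLattice,
        Module.finrank ℤ (Q.rescale (-1)) = 3 ∧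
        (Q.rescale (-1)).IsNegDef ∧
        3 * (Q.rescale (-1)).det = -(2 * (d : ℤ)) ∧
        (LA.perp h).form.Equivalent (twoUtwoE8 (Q.rescale (-1))).form ∧
        Nonempty (DiscIso (Q.rescale (-1)) (LA.perp h)) ∧
        IsAddCyclic (Q.rescale (-1)).D ∧
        3 * Nat.card (Q.rescale (-1)).D = 2 * d) ∧
      (∃ Φ : LA.OplusFix h ≃* (LA.perp h).stableOplus,
        ∀ (g : LA.OplusFix h) (x : LA.perp h),
          perpVal ((Φ g).1.1 x) = g.1.1 (perpVal x)) ∧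
      (∀ H : AddSubgroup (LA.perp h).D,
        (∀ x ∈ H, (LA.perp h).q x = 0) → IsAddCyclic H)) ∧
    (divisor h = 1 →
      (∃ (φ : (LA.perp h).form.IsometryEquiv (LA2d d).form)
          (Φ : LA.OplusFix h ≃* OG d),
        ∀ (g : LA.OplusFix h) (x : LA.perp h),
          perpVal (φ.symm ((Φ g).1.1 (φ x))) = g.1.1 (perpVal x)) ∧
      Nonempty (DiscSumIso (LA.perp h) (A2.rescale (-1)) (rankOne (-d))) ∧
      (∀ H : AddSubgroup (LA.perp h).D,
        (∀ x ∈ H, (LA.perp h).q x = 0) → IsAddCyclic H)) ∧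
    (∀ H : AddSubgroup ((A2.rescale (-1)).D × (rankOne (-d)).D),
      (∀ x ∈ H, (A2.rescale (-1)).q x.1 + (rankOne (-d)).q x.2 = 0) → IsAddCyclic H) := by

  -- `LA` unfolds to `U ⊞ MA`, so the normal forms apply directly; the divisor is always 1 or 3, so
  -- they also settle the signature.
  refine ⟨?_, ?_, ?_, isotropic_isAddCyclic hd⟩
  · rcases exists_normalForm hd hprim hsq with ⟨-, ψ, hψ⟩ | ⟨hdiv, k, hk, hdk, ψ, hψ⟩
    · exact (perp_of_divisor_one hd ψ hψ).2.2.2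
    · exact (perp_of_divisor_three hprim hsq hdiv hk hdk ψ hψ).1
  · intro hdiv
    rcases exists_normalForm hd hprim hsq with ⟨h1, -⟩ | ⟨-, k, hk, hdk, ψ, hψ⟩
    · exact absurd (hdiv.symm.trans h1) (by norm_num)
    · exact (perp_of_divisor_three hprim hsq hdiv hk hdk ψ hψ).2
  · intro hdiv
    rcases exists_normalForm hd hprim hsq with ⟨-, ψ, hψ⟩ | ⟨h3, -⟩
    · have h1 := perp_of_divisor_one hd ψ hψ
      exact ⟨h1.1, h1.2.1, h1.2.2.1⟩
    · exact absurd (hdiv.symm.trans h3) (by norm_num)
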